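/- Let $k$ be a number field and let $G$ be a finite group. A variety over $k$ means a separated scheme of finite type over $k$ (not necessarily reduced). Let $Y$ be an irreducible quasi-projective variety over $k$, endowed with an action of $G$ by $k$-automorphisms such that the induced action of $G$ on the underlying reduced scheme $Y_{\mathrm{red}}$ is faithful (if $Y$ is reduced, this just means that the action of $G$ on $Y$ is faithful). Let $Y/G$ be the quotient variety, i.e. the variety over $k$ characterised by the universal property that $G$-invariant $k$-morphisms from $Y$ to varieties over $k$ factor uniquely through $Y \to Y/G$. If $Y/G$ is rational over $k$, that is, if it contains a dense open subset isomorphic over $k$ to a dense open subset of an affine space $\mathbf{A}^n_k$ for some $n \geq 0$, then the inverse Galois problem has a positive solution for $G$ over $k$: there exists a finite Galois field extension $K/k$ such that $\mathrm{Gal}(K/k) \simeq G$. -/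

import Mathlib

open CategoryTheory AlgebraicGeometry

universe u v

noncomputable section

namespace InverseGalois

/-- Schemes over the field `k`, with `k`-morphisms. -/
abbrev SchOver (k : Type u) [Field k] : Type (u + 1) :=
  Over (Spec (CommRingCat.of k))

/-- A variety over `k`: a separated scheme of finite type over `k`. It may be reducible,
disconnected or non-reduced. -/
structure IsVariety {k : Type u} [Field k] (X : SchOver k) : Prop where
  isSeparated : IsSeparated X.hom
  locallyOfFiniteType : LocallyOfFiniteType X.hom
  quasiCompact : QuasiCompact X.hom

/-- The structure morphism of `Proj k[x_0, …, x_N]` over `k`. -/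
def projectiveSpaceHom (k : Type u) [Field k] (N : ℕ) :
    letI : GradedAlgebra (MvPolynomial.homogeneousSubmodule (Fin (N + 1)) k) :=
      MvPolynomial.gradedAlgebra
    Proj (MvPolynomial.homogeneousSubmodule (Fin (N + 1)) k) ⟶ Spec (CommRingCat.of k) :=
  letI : GradedAlgebra (MvPolynomial.homogeneousSubmodule (Fin (N + 1)) k) :=
    MvPolynomial.gradedAlgebra
  Proj.toSpecZero (MvPolynomial.homogeneousSubmodule (Fin (N + 1)) k) ≫
    Spec.map (CommRingCat.ofHom
      (algebraMap k (MvPolynomial.homogeneousSubmodule (Fin (N + 1)) k 0)))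

/-- The projective space of dimension `N` over `k`. -/
def projectiveSpace (k : Type u) [Field k] (N : ℕ) : SchOver k :=
  Over.mk (projectiveSpaceHom k N)

/-- `X` is quasi-projective over `k`: it is isomorphic over `k` to a locally closed subscheme
of some projective space over `k`. -/
def IsQuasiProjective {k : Type u} [Field k] (X : SchOver k) : Prop :=
  ∃ (N : ℕ) (i : X ⟶ projectiveSpace k N), IsImmersion i.left

/-- `X` is rational over `k`: some dense open subscheme of `X` is isomorphic over `k` to a dense
open subscheme of the affine space of dimension `n` over `k`, for some natural number `n`. -/
def IsRational {k : Type u} [Field k] (X : SchOver k) : Prop :=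
  ∃ n : ℕ, Scheme.BirationalOver X.hom
    (𝔸(ULift.{u} (Fin n); Spec (CommRingCat.of k)) ↘ Spec (CommRingCat.of k))

/-- The action `ρ` of `G` on `Y` by `k`-automorphisms is faithful on the underlying reduced
scheme: only `1` restricts to the inclusion on `Y_red ⊆ Y`. When `Y` is reduced this says that
`ρ` is injective. -/
def IsFaithfulOnReduced {k : Type u} [Field k] {G : Type v} [Group G] {Y : SchOver k}
    (ρ : G →* Aut Y) : Prop :=
  ∀ g : G, Y.left.nilradical.subschemeι ≫ (ρ g).hom.left = Y.left.nilradical.subschemeι → g = 1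

/-- `π : Y ⟶ X` exhibits the variety `X` as the quotient variety `Y/G`: it is `G`-invariant, and
every `G`-invariant morphism from `Y` to a variety over `k` factors uniquely through `π`. -/
structure IsQuotientVariety {k : Type u} [Field k] {G : Type v} [Group G] {Y X : SchOver k}
    (ρ : G →* Aut Y) (π : Y ⟶ X) : Prop where
  isVariety : IsVariety X
  invariant : ∀ g : G, (ρ g).hom ≫ π = π
  existsUnique_desc : ∀ Z : SchOver k, IsVariety Z → ∀ f : Y ⟶ Z,
    (∀ g : G, (ρ g).hom ≫ f = f) → ∃! h : X ⟶ Z, π ≫ h = f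

end InverseGalois

end

/-! The residue field `L` of `Y` at its generic point carries a faithful action of `G`: an element
acting trivially on `L` acts trivially on `Y_red`, because `Y` is separated and the generic point is
dense. As `X = Y/G` is rational, its generic point has residue field `E = k(t₁, …, tₙ)`. It is shown
that `L/E` is Galois with group `G`, and this extension is then specialized to `k`.

The quotient is known only through maps to varieties, so `E = L^G` must be extracted from one
well-chosen invariant map. Embed `Y` in a projective space and send `y` to the product over `g` of
the linear forms whose coefficients are the coordinates of `g y`. The coefficients of this Chow form
define a `G`-invariant morphism to another projective space (`exists_chowMorphism`), which therefore
descends to `X`. Hence the Chow form of the generic point has, once normalized, coefficients in `E`.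
Its linear substitutions are polynomials over `E` that split in `L`, with the conjugates of
combinations of the coordinates as roots. As the coordinates generate `L`, the extension is Galois
and `G` exhausts its group (`isGalois_of_chowForm`).

For the specialization, `L` is regarded as a finite extension of `ℚ(t)`. At a rational point where
the minimal polynomial of an integral primitive element stays irreducible, the residue extension has
full degree, so the decomposition group is the whole Galois group
(`exists_galois_residue_extension`).

Such a point comes from Hilbert irreducibility over `ℚ`, proved one variable `w` at a time
(`exists_irreducible_specialize_inv`). If `f` factored at every `w = 1 / N`, the factors would pick
subsets of the analytic roots of `f` near `w = 0`. By van der Waerden, one subset is picked along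
infinitely many long progressions of one step. A symmetric function of these roots, multiplied by `D
N ^ m`, is then an integer along the progressions, and finite differences force it to be a
polynomial in `1 / N` (`exists_polynomial_of_frequently_int`). The factors thus come from a
factorization of `f` itself. -/

namespace InverseGalois

/-! ### Analytic functions with integral values along progressions -/

section IntegerValues

open Filter Topology Polynomial

/-- Van der Waerden's theorem with bounded step: for a finite colouring of `ℕ` there are a step `a`
and a colour `c` such that infinitely many progressions of step `a` have colour `c`. -/
theorem exists_frequently_monochromatic {κ : Type*} [Finite κ] (C : ℕ → κ) (M : ℕ) :
    ∃ a > 0, ∃ c, ∃ᶠ N in atTop, ∀ i ≤ M, C (N + i * a) = c := by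
  classical
  obtain ⟨ι, _, hι⟩ := Combinatorics.Line.exists_mono_in_high_dimension (Fin (M + 1)) κ
  -- In Hales–Jewett the step is the number of active coordinates of the line. It is at most
  -- `Fintype.card ι`, whatever the starting point `N₀`, so only finitely many pairs (step, colour)
  -- occur and one of them recurs.
  have key : ∀ N₀ : ℕ, ∃ p : Fin (Fintype.card ι + 1) × κ, ∃ N ≥ N₀,
      0 < p.1.1 ∧ ∀ i ≤ M, C (N + i * p.1.1) = p.2 := by
    intro N₀
    obtain ⟨l, c, hl⟩ := hι fun v => C (N₀ + ∑ i, (v i : ℕ))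
    set s : Finset ι := {i | l.idxFun i = none} with hs
    refine ⟨(⟨s.card, Nat.lt_succ_of_le s.card_le_univ⟩, c),
      N₀ + ∑ i ∈ sᶜ, (((l.idxFun i).getD 0 : Fin (M + 1)) : ℕ), Nat.le_add_right _ _,
      Finset.card_pos.mpr ⟨l.proper.choose, ?_⟩, fun i hi => ?_⟩
    · simp [hs, l.proper.choose_spec]
    · change C (_ + i * s.card) = c
      rw [← hl ⟨i, Nat.lt_succ_of_le hi⟩]
      beta_reduce
      rw [← Finset.sum_add_sum_compl s, add_assoc]
      congr 2
      rw [add_comm]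
      congr 1
      · rw [Finset.sum_congr rfl (g := fun _ => i), Finset.sum_const, smul_eq_mul, mul_comm]
        intro j hj
        rw [hs, Finset.mem_filter] at hj
        rw [l.apply_none _ _ hj.right]
      · refine Finset.sum_congr rfl fun j hj => ?_
        rw [hs, Finset.compl_filter, Finset.mem_filter] at hj
        obtain ⟨y, hy⟩ := Option.ne_none_iff_exists.mp hj.right
        rw [l.apply_some hy.symm, ← hy, Option.getD_some]
  by_contra! hcon
  have : ∀ p : Fin (Fintype.card ι + 1) × κ, ∀ᶠ N in atTop,
      ¬ (0 < p.1.1 ∧ ∀ i ≤ M, C (N + i * p.1.1) = p.2) := by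
    intro p
    by_cases h0 : 0 < p.1.1
    · have := hcon p.1.1 h0 p.2
      filter_upwards [this] with N hN h
      obtain ⟨i, hi, hne⟩ := hN
      exact hne (h.2 i hi)
    · exact Eventually.of_forall fun N h => h0 h.1
  obtain ⟨N₀, hN₀⟩ := eventually_atTop.mp (eventually_all.mpr this)
  obtain ⟨p, N, hN, hp⟩ := key N₀
  exact hN₀ N hN p hp

/-- The first difference also tends to `0`, so by induction it vanishes for large `N`. Then `s` is
eventually constant along each progression of step `a`, with limit `0`. -/
theorem eventually_eq_zero_of_fwdDiff {a : ℕ} (ha : 0 < a) (M : ℕ) {s : ℕ → ℂ}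
    (hs : Tendsto s atTop (𝓝 0)) (h : ∀ᶠ N in atTop, (fwdDiff a)^[M] s N = 0) :
    ∀ᶠ N in atTop, s N = 0 := by
  induction M generalizing s with
  | zero => simpa using h
  | succ M ih =>
    have h1 : ∀ᶠ N in atTop, fwdDiff a s N = 0 := by
      refine ih ?_ (by simpa only [Function.iterate_succ_apply] using h)
      have : Tendsto (fun N => s (N + a) - s N) atTop (𝓝 (0 - 0)) :=
        (hs.comp (tendsto_add_atTop_nat a)).sub hs
      rw [sub_zero] at this
      exact this
    obtain ⟨N₀, hN₀⟩ := eventually_atTop.mp h1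
    refine eventually_atTop.mpr ⟨N₀, fun N hN => ?_⟩
    have hstep : ∀ j : ℕ, s (N + j * a) = s N := by
      intro j
      induction j with
      | zero => simp
      | succ j ihj =>
        have := hN₀ (N + j * a) (hN.trans (Nat.le_add_right _ _))
        rw [fwdDiff, sub_eq_zero] at this
        rw [← ihj, ← this]; congr 1; ring
    have hlim : Tendsto (fun j : ℕ => s (N + j * a)) atTop (𝓝 0) :=
      hs.comp (tendsto_atTop_mono (fun j => by
        have := Nat.le_mul_of_pos_right j ha
        simp only [id]; omega) tendsto_id)
    simp only [hstep] at hlim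
    exact tendsto_nhds_unique tendsto_const_nhds hlim

/-- Iterating `dslope` gives an identity valid for every `w`, not only near `0`, so it can be used
at each `1 / N`. -/
theorem exists_taylor {φ : ℂ → ℂ} (hφ : AnalyticAt ℂ φ 0) (m : ℕ) :
    ∃ (q : ℂ[X]) (ψ : ℂ → ℂ), q.natDegree < m + 1 ∧ AnalyticAt ℂ ψ 0 ∧
      ∀ w, φ w = q.eval w + w ^ (m + 1) * ψ w := by
  have hd : ∀ φ : ℂ → ℂ, AnalyticAt ℂ φ 0 → AnalyticAt ℂ (dslope φ 0) 0 := by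
    rintro φ ⟨p, hp⟩
    exact ⟨_, hp.has_fpower_series_dslope_fslope⟩
  have hs : ∀ (φ : ℂ → ℂ) (w : ℂ), φ w = φ 0 + w * dslope φ 0 w := by
    intro φ w
    have := sub_smul_dslope φ 0 w
    rw [sub_zero, smul_eq_mul] at this
    rw [this]; ring
  induction m generalizing φ with
  | zero =>
    exact ⟨C (φ 0), dslope φ 0, by simp, hd φ hφ, fun w => by
      simpa using hs φ w⟩
  | succ m ih =>
    obtain ⟨q, ψ, hq, hψ, h⟩ := ih (hd φ hφ)
    refine ⟨C (φ 0) + X * q, ψ, ?_, hψ, fun w => ?_⟩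
    · refine lt_of_le_of_lt (natDegree_add_le _ _) (max_lt (by simp) ?_)
      refine lt_of_le_of_lt natDegree_mul_le ?_
      rw [natDegree_X]; omega
    · rw [hs φ w, h w]
      simp only [eval_add, eval_C, eval_mul, eval_X]
      ring

theorem fwdDiff_iter_polynomial_eq_zero (P : ℂ[X]) {M : ℕ} (hP : P.natDegree < M) (a N : ℕ) :
    (fwdDiff a)^[M] (fun n : ℕ => P.eval (n : ℂ)) N = 0 := by
  rw [fwdDiff_iter_eq_sum_shift]
  set Q : ℂ[X] := P.comp (C (a : ℂ) * X + C (N : ℂ)) with hQ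
  have hdeg : Q.natDegree < M :=
    lt_of_le_of_lt (natDegree_comp_le.trans (by
      have : (C (a : ℂ) * X + C (N : ℂ)).natDegree ≤ 1 := natDegree_linear_le
      nlinarith)) hP
  have h := congrFun (Polynomial.fwdDiff_iter_eq_zero_of_degree_lt hdeg) 0
  rw [fwdDiff_iter_eq_sum_shift] at h
  rw [← Pi.zero_apply (M := fun _ : ℂ => ℂ) (0 : ℂ), ← h]
  refine Finset.sum_congr rfl fun k _ => ?_
  congr 1
  rw [hQ, eval_comp]
  congr 1
  simp
  ring

/-- If `φ` is analytic at `0` and `D N ^ m φ (1 / N)` is an integer along infinitely many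
long progressions of a fixed step, then `φ` is a polynomial function at large `1 / N`. -/
theorem exists_polynomial_of_frequently_int {φ : ℂ → ℂ} (hφ : AnalyticAt ℂ φ 0) (m D : ℕ)
    (hD : D ≠ 0) {a M : ℕ} (ha : 0 < a) (hM : m < M)
    (h : ∃ᶠ N : ℕ in atTop, ∀ i ≤ M, ∃ z : ℤ,
      (D : ℂ) * ((N + i * a : ℕ) : ℂ) ^ m * φ (((N + i * a : ℕ) : ℂ)⁻¹) = z) :
    ∃ p : ℂ[X], ∀ᶠ N : ℕ in atTop, φ ((N : ℂ)⁻¹) = p.eval (N : ℂ)⁻¹ := by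
  obtain ⟨q, ψ, hq, hψ, hφq⟩ := exists_taylor hφ m
  refine ⟨q, ?_⟩
  -- `D N ^ m q(1 / N)` is a polynomial in `N` of degree at most `m < M`, which the `M`-th
  -- difference kills.
  set P : ℂ[X] := C (D : ℂ) * q.reflect m with hP
  have hPdeg : P.natDegree < M := by
    refine lt_of_le_of_lt (natDegree_C_mul_le _ _) (lt_of_le_of_lt (natDegree_reflect_le) ?_)
    omega
  have hPval : ∀ N : ℕ, N ≠ 0 → P.eval (N : ℂ) = D * (N : ℂ) ^ m * q.eval (N : ℂ)⁻¹ := by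
    intro N hN
    have hN' : (N : ℂ) ≠ 0 := Nat.cast_ne_zero.mpr hN
    let _ : Invertible ((N : ℂ)⁻¹) := invertibleOfNonzero (inv_ne_zero hN')
    have := eval₂_reflect_mul_pow (RingHom.id ℂ) (N : ℂ)⁻¹ m q (by omega)
    simp only [invOf_eq_inv, inv_inv, eval₂_id] at this
    rw [hP, eval_mul, eval_C, ← this, inv_pow]
    field_simp
  set ρ : ℂ → ℂ := fun w => D * (w * ψ w) with hρ
  have hρan : AnalyticAt ℂ ρ 0 := analyticAt_const.mul (analyticAt_id.mul hψ)
  set s : ℕ → ℂ := fun N => ρ ((N : ℂ)⁻¹) with hs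
  have hinv : Tendsto (fun N : ℕ => ((N : ℂ)⁻¹)) atTop (𝓝 0) := tendsto_inv_atTop_nhds_zero_nat
  have hs0 : Tendsto s atTop (𝓝 0) := by
    have := hρan.continuousAt.tendsto.comp hinv
    simpa [hρ, hs, Function.comp_def] using this
  have hdec : ∀ N : ℕ, N ≠ 0 →
      (D : ℂ) * (N : ℂ) ^ m * φ ((N : ℂ)⁻¹) = P.eval (N : ℂ) + s N := by
    intro N hN
    have hN' : (N : ℂ) ≠ 0 := Nat.cast_ne_zero.mpr hN
    rw [hPval N hN, hφq]
    simp only [hs, hρ]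
    rw [pow_succ, inv_pow]
    generalize (N : ℂ)⁻¹ = y at *
    field_simp
  have hΔ0 : Tendsto (fun N => (fwdDiff a)^[M] s N) atTop (𝓝 0) := by
    simp only [fwdDiff_iter_eq_sum_shift]
    rw [show (0 : ℂ) = ∑ k ∈ Finset.range (M + 1), ((-1 : ℤ) ^ (M - k) * (M.choose k : ℤ)) • (0 : ℂ)
      by simp]
    exact tendsto_finsetSum _ fun k _ =>
      (hs0.comp (tendsto_add_atTop_nat (k • a))).const_smul _
  have hfreq : ∃ᶠ N in atTop, (fwdDiff a)^[M] s N = 0 := by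
    have hsmall : ∀ᶠ N in atTop, ‖(fwdDiff a)^[M] s N‖ < 1 := by
      have := hΔ0.norm
      rw [norm_zero] at this
      exact this.eventually (gt_mem_nhds one_pos)
    refine ((h.and_eventually hsmall).and_eventually (eventually_gt_atTop 0)).mono ?_
    rintro N ⟨⟨hN, hlt⟩, hpos⟩
    choose! z hz using hN
    -- Since the polynomial part drops out, the difference of `s` is that of `D N ^ m φ(1 / N)`: an
    -- integer, and of absolute value less than `1`.
    have hint : (fwdDiff a)^[M] s N =
        ((∑ k ∈ Finset.range (M + 1), ((-1 : ℤ) ^ (M - k) * (M.choose k : ℤ)) * z k : ℤ) : ℂ) := by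
      have h0 := fwdDiff_iter_polynomial_eq_zero P hPdeg a N
      rw [fwdDiff_iter_eq_sum_shift] at h0 ⊢
      rw [← add_zero (∑ k ∈ _, _), ← h0, ← Finset.sum_add_distrib, Int.cast_sum]
      refine Finset.sum_congr rfl fun k hk => ?_
      rw [← smul_add, Int.cast_mul, ← hz k (by simpa [Nat.lt_succ_iff] using hk), hdec _ (by omega),
        zsmul_eq_mul, smul_eq_mul, add_comm (s _)]
    rw [hint] at hlt ⊢
    rw [Complex.norm_intCast] at hlt
    have : |(∑ k ∈ Finset.range (M + 1), ((-1 : ℤ) ^ (M - k) * (M.choose k : ℤ)) * z k)| < 1 := by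
      exact_mod_cast hlt
    rw [Int.abs_lt_one_iff] at this
    rw [this, Int.cast_zero]
  -- With `w = 1 / N`, the number `1 / (N + k a)` is `w / (1 + k a w)`. The difference is thus an
  -- analytic function of `w` whose zeros accumulate at `0`, hence zero near `0`.
  set Θ : ℂ → ℂ := fun w => ∑ k ∈ Finset.range (M + 1),
    ((-1 : ℤ) ^ (M - k) * (M.choose k : ℤ)) • ρ (w / (1 + (k * a : ℕ) * w)) with hΘ
  have hΘan : AnalyticAt ℂ Θ 0 := by
    refine Finset.analyticAt_fun_sum _ fun k _ => ?_
    simp only [zsmul_eq_mul]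
    refine analyticAt_const.mul (AnalyticAt.fun_comp (by simpa using hρan) ?_)
    exact analyticAt_id.div (analyticAt_const.add (analyticAt_const.mul analyticAt_id)) (by simp)
  have hΘval : ∀ N : ℕ, N ≠ 0 → Θ ((N : ℂ)⁻¹) = (fwdDiff a)^[M] s N := by
    intro N hN
    have hN' : (N : ℂ) ≠ 0 := Nat.cast_ne_zero.mpr hN
    rw [fwdDiff_iter_eq_sum_shift]
    refine Finset.sum_congr rfl fun k _ => ?_
    congr 1
    simp only [hs]
    congr 1
    push_cast
    rw [smul_eq_mul]
    have : (N : ℂ) + k * a ≠ 0 := by exact_mod_cast (by omega : N + k * a ≠ 0)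
    push_cast
    field_simp
  have hinv' : Tendsto (fun N : ℕ => ((N : ℂ)⁻¹)) atTop (𝓝[≠] 0) :=
    tendsto_nhdsWithin_iff.mpr ⟨hinv, by
      filter_upwards [eventually_gt_atTop 0] with N hN
      simpa using hN.ne'⟩
  have hΘ0 : ∀ᶠ w in 𝓝 0, Θ w = 0 := by
    rw [← hΘan.frequently_zero_iff_eventually_zero]
    refine hinv'.frequently ((hfreq.and_eventually (eventually_gt_atTop 0)).mono ?_)
    rintro N ⟨hN, hpos⟩
    rw [hΘval N hpos.ne', hN]
  have hev : ∀ᶠ N in atTop, (fwdDiff a)^[M] s N = 0 := by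
    filter_upwards [hinv.eventually hΘ0, eventually_gt_atTop 0] with N hN hpos
    rw [← hΘval N hpos.ne', hN]
  filter_upwards [eventually_eq_zero_of_fwdDiff ha M hs0 hev, eventually_gt_atTop 0] with N hN hpos
  have hN' : (N : ℂ) ≠ 0 := Nat.cast_ne_zero.mpr hpos.ne'
  have hD' : (D : ℂ) ≠ 0 := Nat.cast_ne_zero.mpr hD
  rw [hφq]
  simp only [hs, hρ] at hN
  have : (N : ℂ)⁻¹ ^ (m + 1) * ψ (N : ℂ)⁻¹ = 0 := by
    rcases mul_eq_zero.mp hN with h | h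
    · exact absurd h hD'
    · rw [pow_succ, mul_assoc, h, mul_zero]
  rw [this, add_zero]

end IntegerValues

/-! ### Analytic dependence of simple roots -/

section AnalyticRoots

open Filter Topology Polynomial
open scoped ContDiff

/-- The implicit function theorem applies at a simple root, where the derivative in the second
variable is invertible. -/
theorem exists_analytic_root (p : ℂ[X][X]) (ρ : ℂ)
    (h0 : (p.map (evalRingHom 0)).eval ρ = 0)
    (h1 : (p.map (evalRingHom 0)).derivative.eval ρ ≠ 0) :
    ∃ r : ℂ → ℂ, AnalyticAt ℂ r 0 ∧ r 0 = ρ ∧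
      ∀ᶠ w in 𝓝 0, (p.map (evalRingHom w)).eval (r w) = 0 := by
  set f : ℂ × ℂ → ℂ := fun v => (p.map (evalRingHom v.1)).eval v.2 with hf
  have hf' : f = fun v => ∑ i ∈ Finset.range (p.natDegree + 1), (p.coeff i).eval v.1 * v.2 ^ i := by
    funext v
    change (p.map (evalRingHom v.1)).eval v.2 = _
    rw [Polynomial.eval_map, eval₂_eq_sum_range]
    rfl
  have hcd : ContDiff ℂ ω f := by
    rw [hf']
    refine ContDiff.sum fun i _ => ContDiff.mul ?_ (contDiff_snd.pow i)
    exact ((p.coeff i).contDiff_aeval ω).comp contDiff_fst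
  have cdf : ContDiffAt ℂ ω f (0, ρ) := hcd.contDiffAt
  have hpn : (ω : WithTop ℕ∞) ≠ 0 := by simp
  have hder : fderiv ℂ f (0, ρ) ∘L .inr ℂ ℂ ℂ =
      (ContinuousLinearEquiv.unitsEquivAut ℂ (Units.mk0 _ h1) : ℂ →L[ℂ] ℂ) := by
    have e1 : HasFDerivAt (f ∘ fun x : ℂ => ((0 : ℂ), x)) (fderiv ℂ f (0, ρ) ∘L .inr ℂ ℂ ℂ) ρ :=
      HasFDerivAt.comp ρ ((cdf.differentiableAt hpn).hasFDerivAt) (hasFDerivAt_prodMk_right 0 ρ)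
    have e2 : HasDerivAt (f ∘ fun x : ℂ => ((0 : ℂ), x))
        ((p.map (evalRingHom 0)).derivative.eval ρ) ρ :=
      (p.map (evalRingHom 0)).hasDerivAt ρ
    rw [e1.unique e2.hasFDerivAt]
    ext
    simp
  have hif : (fderiv ℂ f ((0, ρ) : ℂ × ℂ) ∘L .inr ℂ ℂ ℂ).IsInvertible := ⟨_, hder.symm⟩
  refine ⟨cdf.implicitFunction hpn hif, ?_, ?_, ?_⟩
  · exact (cdf.contDiffAt_implicitFunction hpn hif).analyticAt
  · exact cdf.implicitFunction_apply_self hpn hif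
  · filter_upwards [cdf.eventually_apply_implicitFunction hpn hif] with w hw
    exact hw.trans h0

/-- A monic polynomial over `ℂ[w]` with simple roots at `w = 0` has analytic roots near `0`. -/
theorem exists_analytic_roots (p : ℂ[X][X]) (hp : p.Monic)
    (hsep : (p.map (evalRingHom 0)).Separable) :
    ∃ r : Fin p.natDegree → ℂ → ℂ, (∀ i, AnalyticAt ℂ (r i) 0) ∧
      ∀ᶠ w in 𝓝 0, p.map (evalRingHom w) = ∏ i, (X - C (r i w)) := by
  classical
  set p0 := p.map (evalRingHom 0) with hp0
  have hp0m : p0.Monic := hp.map _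
  have hcard : p0.roots.toFinset.card = p.natDegree := by
    rw [Multiset.toFinset_card_of_nodup (nodup_roots hsep),
      IsAlgClosed.card_roots_eq_natDegree, hp.natDegree_map]
  set e := (Finset.equivFinOfCardEq hcard).symm with he
  have hroot : ∀ i, p0.eval (e i : ℂ) = 0 := fun i =>
    (mem_roots hp0m.ne_zero).mp (Multiset.mem_toFinset.mp (e i).2)
  choose r hr hr0 hrz using fun i => exists_analytic_root p (e i) (hroot i)
    (hsep.eval₂_derivative_ne_zero (RingHom.id ℂ) (hroot i))
  refine ⟨r, hr, ?_⟩
  have hdist : ∀ᶠ w in 𝓝 0, ∀ i j, i ≠ j → r i w ≠ r j w := by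
    refine eventually_all.mpr fun i => eventually_all.mpr fun j => ?_
    by_cases hij : i = j
    · exact Eventually.of_forall fun _ h => absurd hij h
    · have : r i 0 ≠ r j 0 := by
        rw [hr0, hr0]
        exact fun h => hij (e.injective (Subtype.ext h))
      filter_upwards [((hr i).sub (hr j)).continuousAt.eventually_ne (sub_ne_zero.mpr this)]
        with w hw _ using sub_ne_zero.mp hw
  filter_upwards [hdist, eventually_all.mpr hrz] with w hw hz
  refine (eq_of_monic_of_dvd_of_natDegree_le (monic_prod_X_sub_C _ _) (hp.map _) ?_ ?_)
  · refine Finset.prod_dvd_of_coprime (fun i _ j _ hij => ?_) fun i _ => ?_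
    · exact pairwise_coprime_X_sub_C (fun a b h => by_contra fun hab => hw a b hab h) hij
    · exact dvd_iff_isRoot.mpr (hz i)
  · rw [natDegree_prod_of_monic _ _ fun i _ => monic_X_sub_C _, hp.natDegree_map]
    simp

end AnalyticRoots

/-! ### Interpolation on a finite grid -/

section Grid

open Polynomial

/-- On a finite-dimensional space of polynomials, finitely many evaluations outside a given
hypersurface determine a polynomial linearly. -/
theorem exists_interpolation {σ : Type*} [Finite σ] (V : Submodule ℚ (MvPolynomial σ ℚ))
    [FiniteDimensional ℚ V] {r : MvPolynomial σ ℚ} (hr : r ≠ 0) :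
    ∃ (T : Finset (σ → ℚ)) (Λ : (σ → ℚ) → MvPolynomial σ ℚ), (∀ t ∈ T, MvPolynomial.eval t r ≠ 0) ∧
      ∀ p ∈ V, p = ∑ t ∈ T, MvPolynomial.eval t p • Λ t := by
  classical
  set K : Finset (σ → ℚ) → Submodule ℚ V := fun T =>
    ⨅ t ∈ T, LinearMap.ker ((MvPolynomial.aeval (R := ℚ) t).toLinearMap ∘ₗ V.subtype) with hK
  have memK : ∀ T (p : V), p ∈ K T ↔ ∀ t ∈ T, MvPolynomial.eval t (p : MvPolynomial σ ℚ) = 0 := by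
    intro T p
    simp only [hK, Submodule.mem_iInf, LinearMap.mem_ker]
    rfl
  -- `T` is chosen with a minimal space of polynomials in `V` vanishing on it.
  obtain ⟨_, ⟨T, hT, rfl⟩, hmin⟩ := IsArtinian.set_has_minimal
    {W | ∃ T : Finset (σ → ℚ), (∀ t ∈ T, MvPolynomial.eval t r ≠ 0) ∧ K T = W}
    ⟨_, ∅, by simp, rfl⟩
  have hbot : ∀ p ∈ K T, p = 0 := by
    intro p hp
    by_contra hp0
    -- A point where `p * r` is nonzero lies off the hypersurface and could be added to `T`, cutting
    -- the space down further.
    have hpr : (p : MvPolynomial σ ℚ) * r ≠ 0 :=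
      mul_ne_zero (fun h => hp0 (Subtype.ext h)) hr
    obtain ⟨t, ht⟩ : ∃ t, MvPolynomial.eval t ((p : MvPolynomial σ ℚ) * r) ≠ 0 := by
      by_contra! hcon
      exact hpr (MvPolynomial.funext fun t => by rw [hcon t, map_zero])
    rw [map_mul] at ht
    refine hmin (K (insert t T)) ⟨insert t T, fun s hs => ?_, rfl⟩ (lt_of_le_of_ne ?_ ?_)
    · rcases Finset.mem_insert.mp hs with rfl | hs
      exacts [right_ne_zero_of_mul ht, hT s hs]
    · intro q hq
      rw [memK] at hq ⊢
      exact fun s hs => hq s (Finset.mem_insert_of_mem hs)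
    · intro heq
      rw [← heq, memK] at hp
      exact left_ne_zero_of_mul ht (hp t (Finset.mem_insert_self _ _))
  let L : V →ₗ[ℚ] (T → ℚ) := LinearMap.pi fun t =>
    (MvPolynomial.aeval (R := ℚ) t.1).toLinearMap ∘ₗ V.subtype
  have hL : LinearMap.ker L = ⊥ := by
    rw [eq_bot_iff]
    intro p hp
    refine hbot p ((memK T p).mpr fun t ht => ?_)
    exact congrFun (LinearMap.mem_ker.mp hp) ⟨t, ht⟩
  obtain ⟨R, hR⟩ := L.exists_leftInverse_of_injective hL
  -- `Λ t` is the image of the indicator of `t` under a left inverse of evaluation on `T`; its value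
  -- off `T` plays no role.
  refine ⟨T, fun t => if h : t ∈ T then R (Pi.single ⟨t, h⟩ 1) else 0, hT, fun p hp => ?_⟩
  have h1 := LinearMap.congr_fun hR ⟨p, hp⟩
  rw [LinearMap.comp_apply, LinearMap.id_apply, LinearMap.pi_apply_eq_sum_univ R] at h1
  have h2 := congrArg Subtype.val h1
  rw [AddSubmonoidClass.coe_finsetSum] at h2
  rw [← Finset.sum_coe_sort T]
  refine h2.symm.trans (Finset.sum_congr rfl fun t _ => ?_)
  beta_reduce
  rw [dif_pos t.2, SetLike.val_smul]
  congr 2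
  · congr 1
    funext j
    rcases eq_or_ne t j with rfl | h
    · simp
    · simp [h, h.symm]

end Grid

/-! ### Degrees and denominators of factors -/

section Bounds

open Polynomial

/-- With `X` counted as one more variable, total degree is additive on products over a domain. This
confines the coefficients of all factors to one finite-dimensional space. -/
theorem totalDegree_coeff_le_of_mul_eq {σ : Type*} {f g h : (MvPolynomial σ ℚ)[X]} (hf : f ≠ 0)
    (hgh : g * h = f) (j : ℕ) :
    (g.coeff j).totalDegree ≤
      ((MvPolynomial.optionEquivLeft ℚ σ).symm f).totalDegree := by
  have hg : g ≠ 0 := left_ne_zero_of_mul (hgh.trans_ne hf)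
  have hh : h ≠ 0 := right_ne_zero_of_mul (hgh.trans_ne hf)
  set e := (MvPolynomial.optionEquivLeft ℚ σ).symm with he
  have h1 : (g.coeff j).totalDegree ≤ (e g).totalDegree := by
    have := MvPolynomial.totalDegree_coeff_optionEquivLeft_le _ _ (e g) j
    rwa [he, AlgEquiv.apply_symm_apply] at this
  rw [← hgh, map_mul, MvPolynomial.totalDegree_mul_of_isDomain
    (by simpa using hg) (by simpa using hh)]
  omega

/-- The value at a scalar `c` is a combination, with coefficients `c ^ j`, of finitely many terms
independent of `c`. -/
theorem exists_totalDegree_specialize_le {σ : Type*} (f : (MvPolynomial σ ℚ)[X][X]) :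
    ∃ B, ∀ c : ℚ, ((MvPolynomial.optionEquivLeft ℚ σ).symm
      (f.map (evalRingHom (MvPolynomial.C c)))).totalDegree ≤ B := by
  set e := (MvPolynomial.optionEquivLeft ℚ σ).symm with he
  refine ⟨f.support.sup fun i => (f.coeff i).support.sup fun j =>
    (e (C ((f.coeff i).coeff j) * X ^ i)).totalDegree, fun c => ?_⟩
  have h1 : f.map (evalRingHom (MvPolynomial.C c)) = ∑ i ∈ f.support, ∑ j ∈ (f.coeff i).support,
      c ^ j • (C ((f.coeff i).coeff j) * X ^ i) := by
    conv_lhs => rw [f.as_sum_support_C_mul_X_pow]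
    rw [Polynomial.map_sum]
    refine Finset.sum_congr rfl fun i _ => ?_
    rw [Polynomial.map_mul, Polynomial.map_pow, map_C, map_X, coe_evalRingHom, eval_eq_sum,
      Polynomial.sum, map_sum, Finset.sum_mul]
    refine Finset.sum_congr rfl fun j _ => ?_
    rw [← map_pow, mul_comm ((f.coeff i).coeff j), ← MvPolynomial.smul_eq_C_mul, ← smul_C,
      smul_mul_assoc]
  rw [h1, map_sum]
  refine MvPolynomial.totalDegree_finsetSum_le fun i hi => ?_
  rw [map_sum]
  refine MvPolynomial.totalDegree_finsetSum_le fun j hj => ?_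
  rw [map_smul]
  refine (MvPolynomial.totalDegree_smul_le _ _).trans ?_
  refine le_trans ?_ (Finset.le_sup hi)
  exact Finset.le_sup (f := fun j => (e (C ((f.coeff i).coeff j) * X ^ i)).totalDegree) hj

/-- Monic factors of the values at `1 / N` of a monic polynomial over `ℚ[w]` have coefficients with
denominator bounded by a constant times a fixed power of `N`. -/
theorem exists_denominator_bound (q : ℚ[X][X]) (hq : q.Monic) :
    ∃ D m : ℕ, D ≠ 0 ∧ ∀ N : ℕ, N ≠ 0 → ∀ g : ℚ[X], g.Monic →
      g ∣ q.map (evalRingHom (N : ℚ)⁻¹) → ∀ j, ∃ z : ℤ, (D : ℚ) * (N : ℚ) ^ m * g.coeff j = z := by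
  classical
  obtain ⟨D, hD, hDint⟩ : ∃ D : ℕ, D ≠ 0 ∧ ∀ i ∈ q.support, ∀ j ∈ (q.coeff i).support,
      ∃ z : ℤ, (D : ℚ) * (q.coeff i).coeff j = z := by
    refine ⟨∏ i ∈ q.support, ∏ j ∈ (q.coeff i).support, ((q.coeff i).coeff j).den,
      Finset.prod_ne_zero_iff.mpr fun i _ => Finset.prod_ne_zero_iff.mpr fun j _ => Rat.den_nz _,
      fun i hi j hj => ?_⟩
    obtain ⟨b, hb⟩ := (Finset.dvd_prod_of_mem (fun j => ((q.coeff i).coeff j).den) hj).trans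
      (Finset.dvd_prod_of_mem (fun i => ∏ j ∈ (q.coeff i).support, ((q.coeff i).coeff j).den) hi)
    refine ⟨b * ((q.coeff i).coeff j).num, ?_⟩
    rw [hb, Nat.cast_mul, mul_right_comm, mul_comm _ ((q.coeff i).coeff j), Rat.mul_den_eq_num]
    push_cast; ring
  set e := q.support.sup fun i => (q.coeff i).natDegree with he
  set d := q.natDegree with hd
  have hcoef : ∀ N : ℕ, N ≠ 0 → ∀ i, ∃ z : ℤ,
      (D * N ^ e : ℚ) * (q.coeff i).eval (N : ℚ)⁻¹ = z := by
    intro N hN i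
    have hN' : (N : ℚ) ≠ 0 := Nat.cast_ne_zero.mpr hN
    by_cases hi : i ∈ q.support
    · choose! z hz using hDint i hi
      refine ⟨∑ j ∈ (q.coeff i).support, z j * N ^ (e - j), ?_⟩
      rw [eval_eq_sum, Polynomial.sum, Finset.mul_sum, Int.cast_sum]
      refine Finset.sum_congr rfl fun j hj => ?_
      have hje : j ≤ e := (le_natDegree_of_mem_supp j hj).trans
        (Finset.le_sup (f := fun i => (q.coeff i).natDegree) hi)
      rw [Int.cast_mul, ← hz j hj]
      push_cast
      rw [inv_pow, ← Nat.sub_add_cancel hje, pow_add, Nat.add_sub_cancel]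
      field_simp
    · exact ⟨0, by rw [notMem_support_iff.mp hi]; simp⟩
  -- Scaling the roots by `M = D N ^ e` makes them integral. The coefficient of `x ^ j` in `g` is
  -- then multiplied by `M ^ (g.natDegree - j)`, which divides `M ^ d`.
  refine ⟨D ^ d, e * d, pow_ne_zero _ hD, fun N hN g hg hdvd j => ?_⟩
  set M : ℤ := D * N ^ e with hM
  choose z hz using hcoef N hN
  set qN := q.map (evalRingHom (N : ℚ)⁻¹) with hqN
  have hqNm : qN.Monic := hq.map _
  have hqNd : qN.natDegree = d := hq.natDegree_map _
  have hMz : ∀ i, (M : ℚ) * qN.coeff i = z i := by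
    intro i
    rw [← hz i, hqN, coeff_map, coe_evalRingHom, hM]
    push_cast; ring
  have hlift : ∃ Q : ℤ[X], Q.Monic ∧ Q.map (algebraMap ℤ ℚ) = qN.scaleRoots (M : ℚ) := by
    have hmem : qN.scaleRoots (M : ℚ) ∈ lifts (algebraMap ℤ ℚ) := by
      rw [lifts_iff_coeff_lifts]
      intro i
      rw [coeff_scaleRoots, hqNd]
      rcases lt_trichotomy i d with hi | hi | hi
      · refine ⟨z i * M ^ (d - i - 1), ?_⟩
        obtain ⟨k, hk⟩ : ∃ k, d - i = k + 1 := ⟨d - i - 1, by omega⟩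
        rw [hk, Nat.add_sub_cancel, pow_succ', ← mul_assoc, mul_comm (qN.coeff i), hMz]
        simp
      · refine ⟨1, ?_⟩
        rw [hi, Nat.sub_self, pow_zero, mul_one, ← hqNd, hqNm.coeff_natDegree, map_one]
      · refine ⟨0, ?_⟩
        rw [coeff_eq_zero_of_natDegree_lt (by omega), zero_mul, map_zero]
    obtain ⟨Q, hQ1, -, hQ2⟩ := lifts_and_natDegree_eq_and_monic hmem
      ((monic_scaleRoots_iff _).mpr hqNm)
    exact ⟨Q, hQ2, hQ1⟩
  obtain ⟨Q, hQm, hQ⟩ := hlift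
  have hdvd' : g.scaleRoots (M : ℚ) ∣ Q.map (algebraMap ℤ ℚ) := by
    rw [hQ]; exact scaleRoots_dvd _ _ hdvd
  -- Gauss's lemma: a monic rational factor of a monic integral polynomial is integral.
  obtain ⟨g', hg'⟩ := IsIntegrallyClosed.eq_map_mul_C_of_dvd ℚ hQm hdvd'
  rw [((monic_scaleRoots_iff _).mpr hg).leadingCoeff, C_1, mul_one] at hg'
  have hgd : g.natDegree ≤ d := hqNd ▸ natDegree_le_of_dvd hdvd hqNm.ne_zero
  rcases le_or_gt j g.natDegree with hj | hj
  · refine ⟨g'.coeff j * M ^ (d - (g.natDegree - j)), ?_⟩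
    have h1 := congrArg (fun p => p.coeff j) hg'
    simp only [coeff_map, coeff_scaleRoots, eq_intCast] at h1
    rw [Int.cast_mul, h1, Int.cast_pow, mul_assoc, mul_assoc, ← pow_add,
      show g.natDegree - j + (d - (g.natDegree - j)) = d by omega, hM]
    push_cast
    rw [mul_pow, pow_mul]; ring
  · exact ⟨0, by rw [coeff_eq_zero_of_natDegree_lt hj]; simp⟩

/-- A complex polynomial agrees with a rational one wherever it maps a rational number to a
rational number. -/
theorem exists_rational_polynomial (p : ℂ[X]) :
    ∃ P : ℚ[X], ∀ w q : ℚ, p.eval (w : ℂ) = q → P.eval w = q := by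
  -- A `ℚ`-linear retraction `ℂ → ℚ`, applied to the coefficients, commutes with evaluation at
  -- rational points.
  obtain ⟨π, hπ⟩ := (LinearMap.toSpanSingleton ℚ ℂ 1).exists_leftInverse_of_injective
    (LinearMap.ker_toSpanSingleton ℚ one_ne_zero)
  have hπq : ∀ q : ℚ, π (q : ℂ) = q := by
    intro q
    have := LinearMap.congr_fun hπ q
    simpa [Algebra.smul_def] using this
  refine ⟨∑ i ∈ p.support, C (π (p.coeff i)) * X ^ i, fun w q h => ?_⟩
  rw [← hπq q, ← h, eval_finsetSum, eval_eq_sum, Polynomial.sum, map_sum]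
  refine Finset.sum_congr rfl fun i _ => ?_
  rw [eval_mul, eval_C, eval_pow, eval_X, mul_comm (p.coeff i), ← Rat.cast_pow,
    ← Rat.smul_def, map_smul, smul_eq_mul, mul_comm]

theorem exists_subset_of_mul_eq_prod {F ι : Type*} [Field F] [DecidableEq ι] (x : ι → F)
    (s : Finset ι) {g h : F[X]} (hg : g.Monic) (hh : h.Monic) (hgh : g * h = ∏ i ∈ s, (X - C (x i))) :
    ∃ S ⊆ s, g = ∏ i ∈ S, (X - C (x i)) ∧ h = ∏ i ∈ s \ S, (X - C (x i)) := by
  induction s using Finset.induction_on generalizing g h with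
  | empty =>
    rw [Finset.prod_empty] at hgh
    have h1 := hg.isUnit_iff.mp (IsUnit.of_mul_eq_one _ hgh)
    subst h1
    exact ⟨∅, by simp, by simp, by simpa using hgh⟩
  | insert a s ha ih =>
    rw [Finset.prod_insert ha] at hgh
    rcases (prime_X_sub_C (x a)).dvd_or_dvd (Dvd.intro _ hgh.symm) with ⟨g', rfl⟩ | ⟨h', rfl⟩
    · rw [mul_assoc] at hgh
      obtain ⟨S, hS, e1, e2⟩ := ih ((monic_X_sub_C _).of_mul_monic_left hg) hh
        (mul_left_cancel₀ (X_sub_C_ne_zero _) hgh)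
      have haS : a ∉ S := fun h => ha (hS h)
      refine ⟨insert a S, Finset.insert_subset_insert _ hS, ?_, ?_⟩
      · rw [Finset.prod_insert haS, ← e1]
      · rw [e2, Finset.insert_sdiff_insert, Finset.sdiff_insert_of_notMem ha]
    · rw [mul_left_comm] at hgh
      obtain ⟨S, hS, e1, e2⟩ := ih hg ((monic_X_sub_C _).of_mul_monic_left hh)
        (mul_left_cancel₀ (X_sub_C_ne_zero _) hgh)
      have haS : a ∉ S := fun h => ha (hS h)
      refine ⟨S, hS.trans (Finset.subset_insert _ _), e1, ?_⟩
      rw [Finset.insert_sdiff_of_notMem _ haS, Finset.prod_insert (by simp [ha]), ← e2]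

theorem analyticAt_coeff_prod {ι : Type*} {r : ι → ℂ → ℂ} (hr : ∀ i, AnalyticAt ℂ (r i) 0)
    (s : Finset ι) (j : ℕ) :
    AnalyticAt ℂ (fun w => (∏ i ∈ s, (X - C (r i w))).coeff j) 0 := by
  classical
  induction s using Finset.induction_on generalizing j with
  | empty => simpa using analyticAt_const
  | insert a s ha ih =>
    simp only [Finset.prod_insert ha, sub_mul]
    cases j with
    | zero =>
      simp only [coeff_sub, mul_coeff_zero, coeff_X_zero, zero_mul, zero_sub, coeff_C_zero]
      exact ((hr a).mul (ih 0)).neg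
    | succ j =>
      simp only [coeff_sub, coeff_C_mul, coeff_X_mul]
      exact (ih j).sub ((hr a).mul (ih (j + 1)))

end Bounds

/-! ### Specialization of one variable -/

section Specialization

open Polynomial Filter

/-- A family of monic factors of the values at `1 / N` of `f` whose roots on a grid are a fixed
subset of analytic roots along many long progressions comes from one polynomial over `ℚ[w]`. -/
theorem exists_polynomial_family {σ ι : Type*} {f : (MvPolynomial σ ℚ)[X][X]} (hf : f.Monic)
    {T : Finset (σ → ℚ)} {Λ : (σ → ℚ) → MvPolynomial σ ℚ} {D m : (σ → ℚ) → ℕ} {M : ℕ}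
    (hD : ∀ t ∈ T, D t ≠ 0) (hM : ∀ t ∈ T, m t < M)
    (hden : ∀ t ∈ T, ∀ N : ℕ, N ≠ 0 → ∀ g : ℚ[X], g.Monic →
      g ∣ (f.map (mapRingHom (MvPolynomial.eval t))).map (evalRingHom (N : ℚ)⁻¹) →
      ∀ j, ∃ z : ℤ, (D t : ℚ) * (N : ℚ) ^ m t * g.coeff j = z)
    {r : (σ → ℚ) → ι → ℂ → ℂ} (hr : ∀ t ∈ T, ∀ i, AnalyticAt ℂ (r t i) 0)
    {u : ℕ → (MvPolynomial σ ℚ)[X]} (hu : ∀ N, (u N).Monic)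
    (hdvd : ∀ N : ℕ, u N ∣ f.map (evalRingHom (MvPolynomial.C (N : ℚ)⁻¹)))
    (huV : ∀ N j, (u N).coeff j = ∑ t ∈ T, MvPolynomial.eval t ((u N).coeff j) • Λ t)
    {S : ℕ → (σ → ℚ) → Finset ι}
    (hS : ∀ᶠ N : ℕ in atTop, ∀ t ∈ T, ((u N).map (MvPolynomial.eval t)).map (algebraMap ℚ ℂ) =
      ∏ i ∈ S N t, (X - C (r t i (N : ℂ)⁻¹)))
    {a : ℕ} (ha : 0 < a) {c : (σ → ℚ) → Finset ι}
    (hc : ∃ᶠ N in atTop, ∀ i ≤ M, ∀ t ∈ T, S (N + i * a) t = c t) :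
    ∃ G : (MvPolynomial σ ℚ)[X][X], ∀ᶠ N : ℕ in atTop, (∀ t ∈ T, S N t = c t) →
      G.map (evalRingHom (MvPolynomial.C (N : ℚ)⁻¹)) = u N := by
  set φ : (σ → ℚ) → ℕ → ℂ → ℂ := fun t j w => (∏ i ∈ c t, (X - C (r t i w))).coeff j with hφ
  have hcomp : ∀ (t : σ → ℚ) (w : ℚ), (f.map (evalRingHom (MvPolynomial.C w))).map
      (MvPolynomial.eval t) = (f.map (mapRingHom (MvPolynomial.eval t))).map (evalRingHom w) := by
    intro t w
    rw [Polynomial.map_map, Polynomial.map_map]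
    congr 1
    ext <;> simp
  obtain ⟨N₀, hN₀⟩ := eventually_atTop.mp hS
  have hval : ∀ t ∈ T, ∀ j, ∀ N ≥ N₀, S N t = c t →
      φ t j (N : ℂ)⁻¹ = ((MvPolynomial.eval t ((u N).coeff j) : ℚ) : ℂ) := by
    intro t ht j N hN hSN
    simp only [hφ]
    rw [← hSN, ← hN₀ N hN t ht, coeff_map, coeff_map]
    rfl
  have hpoly : ∀ t ∈ T, ∀ j, ∃ p : ℂ[X], ∀ᶠ N : ℕ in atTop, φ t j (N : ℂ)⁻¹ =
      p.eval (N : ℂ)⁻¹ := by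
    intro t ht j
    refine exists_polynomial_of_frequently_int (analyticAt_coeff_prod (hr t ht) (c t) j) (m t) (D t)
      (hD t ht) ha (hM t ht) ?_
    refine (hc.and_eventually (eventually_ge_atTop (N₀ + 1))).mono ?_
    rintro N ⟨hN, hge⟩ i hi
    obtain ⟨z, hz⟩ := hden t ht (N + i * a) (by omega) _ ((hu (N + i * a)).map _)
      (by rw [← hcomp]; exact Polynomial.map_dvd _ (hdvd _)) j
    refine ⟨z, ?_⟩
    have := hval t ht j (N + i * a) (by omega) (hN i hi t ht)
    rw [this]
    rw [coeff_map] at hz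
    exact_mod_cast congrArg (fun q : ℚ => (q : ℂ)) hz
  choose! p hp using hpoly
  choose P hP using fun t j => exists_rational_polynomial (p t j)
  set d := f.natDegree with hd
  -- Each coefficient is interpolated from the grid: `P t j` gives its value at `t` as a polynomial
  -- in `w`.
  refine ⟨∑ j ∈ Finset.range (d + 1),
    C (∑ t ∈ T, (P t j).map MvPolynomial.C * C (Λ t)) * X ^ j, ?_⟩
  have hev : ∀ᶠ N : ℕ in atTop, ∀ t ∈ T, ∀ j ∈ Finset.range (d + 1),
      φ t j (N : ℂ)⁻¹ = (p t j).eval (N : ℂ)⁻¹ :=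
    (eventually_all_finset T).mpr fun t ht => (eventually_all_finset _).mpr fun j _ => hp t ht j
  filter_upwards [hev, eventually_ge_atTop N₀] with N hN hge hSN
  have hdeg : (u N).natDegree < d + 1 := by
    have := natDegree_le_of_dvd (hdvd N) (hf.map _).ne_zero
    rw [hf.natDegree_map] at this
    omega
  rw [(u N).as_sum_range' _ hdeg, Polynomial.map_sum]
  refine Finset.sum_congr rfl fun j hj => ?_
  rw [Polynomial.map_mul, Polynomial.map_pow, map_C, map_X, C_mul_X_pow_eq_monomial]
  congr 1
  rw [huV N j, coe_evalRingHom, eval_finsetSum]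
  refine Finset.sum_congr rfl fun t ht => ?_
  rw [eval_mul, eval_C, Polynomial.eval_map, eval₂_at_apply, MvPolynomial.smul_eq_C_mul]
  congr 2
  refine hP t j _ _ ?_
  rw [← hval t ht j N hge (hSN t ht), hN t ht j hj]
  congr 1
  push_cast
  rfl

theorem eq_of_frequently_map_eq {σ : Type*} {f g : (MvPolynomial σ ℚ)[X][X]}
    (h : ∃ᶠ N : ℕ in atTop, f.map (evalRingHom (MvPolynomial.C (N : ℚ)⁻¹)) =
      g.map (evalRingHom (MvPolynomial.C (N : ℚ)⁻¹))) : f = g := by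
  ext1 i
  refine eq_of_infinite_eval_eq _ _ ((Nat.frequently_atTop_iff_infinite.mp h).image
    (f := fun N : ℕ => (MvPolynomial.C (N : ℚ)⁻¹ : MvPolynomial σ ℚ)) ?_ |>.mono ?_)
  · intro a _ b _ hab
    exact_mod_cast inv_injective (MvPolynomial.C_injective _ _ hab)
  · rintro _ ⟨N, hN, rfl⟩
    have := congrArg (fun p => p.coeff i) hN
    simp only [coeff_map, coe_evalRingHom] at this
    exact this

/-- The condition on `r` allows a grid on which `r(0, t) ≠ 0`, so that over each grid point the
roots at `w = 0` are simple and extend analytically. Colouring `N` by the subsets of roots that a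
factor at `1 / N` selects, the progressions of one colour yield polynomials `G` and `H` that
specialize to the two factors for infinitely many `N`. Then `f = G * H`, with neither a unit. -/
theorem exists_irreducible_specialize_inv {σ : Type*} [Finite σ] {f : (MvPolynomial σ ℚ)[X][X]}
    (hf : f.Monic) (hirr : Irreducible f) {p q : (MvPolynomial σ ℚ)[X][X]}
    {r : (MvPolynomial σ ℚ)[X]} (hpq : f * p + derivative f * q = C r) (hr : r.eval 0 ≠ 0) :
    ∃ c : ℚ, Irreducible (f.map (evalRingHom (MvPolynomial.C c))) := by
  classical
  by_contra! hcon
  set d := f.natDegree with hd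
  have hd0 : d ≠ 0 := by
    intro h
    rw [eq_one_of_monic_natDegree_zero hf h] at hirr
    exact not_irreducible_one hirr
  have hfac : ∀ N : ℕ, ∃ g h : (MvPolynomial σ ℚ)[X], g.Monic ∧ h.Monic ∧
      g * h = f.map (evalRingHom (MvPolynomial.C (N : ℚ)⁻¹)) ∧ g.natDegree ≠ 0 ∧
      h.natDegree ≠ 0 := by
    intro N
    have h1 := hcon (N : ℚ)⁻¹
    rw [(hf.map _).irreducible_iff_natDegree, not_and] at h1
    have h2 := h1 (fun h => hd0 (by rw [hd, ← hf.natDegree_map (evalRingHom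
      (MvPolynomial.C (N : ℚ)⁻¹)), h, natDegree_one]))
    push Not at h2
    obtain ⟨g, h, hg, hh, e, e1, e2⟩ := h2
    exact ⟨g, h, hg, hh, e, e1, e2⟩
  choose g h hg hh hgh hgd hhd using hfac
  obtain ⟨B, hB⟩ := exists_totalDegree_specialize_le f
  obtain ⟨T, Λ, hT, hΛ⟩ := exists_interpolation (MvPolynomial.restrictTotalDegree σ ℚ B) hr
  have hgΛ : ∀ N j, (g N).coeff j = ∑ t ∈ T, MvPolynomial.eval t ((g N).coeff j) • Λ t :=
    fun N j => hΛ _ ((MvPolynomial.mem_restrictTotalDegree _ _ _).mpr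
      ((totalDegree_coeff_le_of_mul_eq (hf.map _).ne_zero (hgh N) j).trans (hB _)))
  have hhΛ : ∀ N j, (h N).coeff j = ∑ t ∈ T, MvPolynomial.eval t ((h N).coeff j) • Λ t :=
    fun N j => hΛ _ ((MvPolynomial.mem_restrictTotalDegree _ _ _).mpr
      ((totalDegree_coeff_le_of_mul_eq (hf.map _).ne_zero ((mul_comm _ _).trans (hgh N)) j).trans
        (hB _)))
  choose D m hD hden using fun t : σ → ℚ => exists_denominator_bound
    (f.map (mapRingHom (MvPolynomial.eval t))) (hf.map _)
  set M := T.sup m + 1 with hMdef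
  have hM : ∀ t ∈ T, m t < M := fun t ht => Nat.lt_succ_of_le (Finset.le_sup ht)
  set F : (σ → ℚ) → ℂ[X][X] := fun t =>
    (f.map (mapRingHom (MvPolynomial.eval t))).map (mapRingHom (algebraMap ℚ ℂ)) with hF
  have hFd : ∀ t, (F t).natDegree = d := fun t => by
    simp only [hF]
    rw [(hf.map _).natDegree_map, hf.natDegree_map]
  have hFm : ∀ t, (F t).Monic := fun t => (hf.map _).map _
  have hFval : ∀ (t : σ → ℚ) (w : ℚ), (F t).map (evalRingHom (w : ℂ)) =
      ((f.map (evalRingHom (MvPolynomial.C w))).map (MvPolynomial.eval t)).map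
        (algebraMap ℚ ℂ) := by
    intro t w
    simp only [hF]
    rw [Polynomial.map_map, Polynomial.map_map, Polynomial.map_map, Polynomial.map_map]
    congr 1
    ext <;> simp
  have hsep : ∀ t ∈ T, ((F t).map (evalRingHom 0)).Separable := by
    intro t ht
    set ψ : (MvPolynomial σ ℚ)[X] →+* ℂ := (algebraMap ℚ ℂ).comp
      ((MvPolynomial.eval t).comp (evalRingHom 0)) with hψ
    have e : (F t).map (evalRingHom 0) = f.map ψ := by
      have := hFval t 0
      rw [Rat.cast_zero, map_zero] at this
      rw [this, Polynomial.map_map, Polynomial.map_map, hψ, RingHom.comp_assoc]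
    have h1 := congrArg (Polynomial.map ψ) hpq
    rw [Polynomial.map_add, Polynomial.map_mul, Polynomial.map_mul, map_C,
      ← derivative_map, ← e] at h1
    have h2 : ψ r ≠ 0 := by
      simpa [hψ] using hT t ht
    refine ⟨C (ψ r)⁻¹ * p.map ψ, C (ψ r)⁻¹ * q.map ψ, ?_⟩
    rw [mul_assoc, mul_assoc, ← mul_add, mul_comm (p.map ψ), mul_comm (q.map ψ), h1, ← C_mul,
      inv_mul_cancel₀ h2, C_1]
  have hroots : ∀ t ∈ T, ∃ ρ : Fin d → ℂ → ℂ, (∀ i, AnalyticAt ℂ (ρ i) 0) ∧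
      ∀ᶠ N : ℕ in atTop, (F t).map (evalRingHom ((N : ℂ)⁻¹)) =
        ∏ i, (X - C (ρ i (N : ℂ)⁻¹)) := by
    intro t ht
    have := exists_analytic_roots (F t) (hFm t) (hsep t ht)
    rw [hFd t] at this
    obtain ⟨ρ, h1, h2⟩ := this
    exact ⟨ρ, h1, tendsto_inv_atTop_nhds_zero_nat.eventually h2⟩
  choose! ρ hρ hρF using hroots
  have hcol : ∀ (N : ℕ) (t : σ → ℚ), ∃ S : Finset (Fin d),
      (F t).map (evalRingHom ((N : ℂ)⁻¹)) = ∏ i, (X - C (ρ t i (N : ℂ)⁻¹)) →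
      ((g N).map (MvPolynomial.eval t)).map (algebraMap ℚ ℂ) =
        ∏ i ∈ S, (X - C (ρ t i (N : ℂ)⁻¹)) ∧
      ((h N).map (MvPolynomial.eval t)).map (algebraMap ℚ ℂ) =
        ∏ i ∈ Sᶜ, (X - C (ρ t i (N : ℂ)⁻¹)) := by
    intro N t
    by_cases hN : (F t).map (evalRingHom ((N : ℂ)⁻¹)) = ∏ i, (X - C (ρ t i (N : ℂ)⁻¹))
    · obtain ⟨S, -, e1, e2⟩ := exists_subset_of_mul_eq_prod (fun i => ρ t i (N : ℂ)⁻¹) Finset.univ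
        (((hg N).map (MvPolynomial.eval t)).map (algebraMap ℚ ℂ))
        (((hh N).map (MvPolynomial.eval t)).map (algebraMap ℚ ℂ)) (by
          rw [← Polynomial.map_mul, ← Polynomial.map_mul, hgh, ← hFval, ← hN]
          push_cast
          rfl)
      exact ⟨S, fun _ => ⟨e1, by rw [e2, Finset.compl_eq_univ_sdiff]⟩⟩
    · exact ⟨∅, fun h => absurd h hN⟩
  choose S hS using hcol
  have hgood : ∀ᶠ N : ℕ in atTop, ∀ t ∈ T,
      (F t).map (evalRingHom ((N : ℂ)⁻¹)) = ∏ i, (X - C (ρ t i (N : ℂ)⁻¹)) :=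
    (eventually_all_finset T).mpr fun t ht => hρF t ht
  -- The colour records the subsets at all grid points simultaneously, so that they share one step.
  obtain ⟨a, ha, c, hc⟩ := exists_frequently_monochromatic (fun N (t : T) => S N t) M
  set c' : (σ → ℚ) → Finset (Fin d) := fun t => if ht : t ∈ T then c ⟨t, ht⟩ else ∅ with hc'
  have hcS : ∀ {N : ℕ}, (fun t : T => S N t) = c → ∀ t ∈ T, S N t = c' t := by
    intro N hN t ht
    simp only [hc', dif_pos ht, ← hN]
  have hfreq : ∃ᶠ N in atTop, ∀ i ≤ M, ∀ t ∈ T, S (N + i * a) t = c' t :=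
    hc.mono fun N hN i hi => hcS (hN i hi)
  obtain ⟨G, hG⟩ := exists_polynomial_family hf (fun t _ => hD t) hM (fun t _ => hden t) hρ hg
    (fun N => Dvd.intro _ (hgh N)) hgΛ (hgood.mono fun N hN t ht => (hS N t (hN t ht)).1) ha hfreq
  -- The cofactor takes the complementary roots, so the same progressions serve for it.
  obtain ⟨H, hH⟩ := exists_polynomial_family hf (fun t _ => hD t) hM (fun t _ => hden t) hρ hh
    (fun N => Dvd.intro_left _ (hgh N)) hhΛ (S := fun N t => (S N t)ᶜ) (c := fun t => (c' t)ᶜ)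
    (hgood.mono fun N hN t ht => (hS N t (hN t ht)).2) ha
    (hfreq.mono fun N hN i hi t ht => by rw [hN i hi t ht])
  have hGH : ∃ᶠ N : ℕ in atTop, G.map (evalRingHom (MvPolynomial.C (N : ℚ)⁻¹)) = g N ∧
      H.map (evalRingHom (MvPolynomial.C (N : ℚ)⁻¹)) = h N := by
    refine (hfreq.and_eventually (hG.and hH)).mono ?_
    rintro N ⟨h0, h1, h2⟩
    have h3 : ∀ t ∈ T, S N t = c' t := fun t ht => by simpa using h0 0 (Nat.zero_le _) t ht
    exact ⟨h1 h3, h2 fun t ht => by rw [h3 t ht]⟩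
  have hfGH : f = G * H := eq_of_frequently_map_eq (hGH.mono fun N hN => by
    rw [Polynomial.map_mul, hN.1, hN.2, hgh])
  obtain ⟨N, h1, h2⟩ := hGH.exists
  rcases hirr.isUnit_or_isUnit hfGH with hu | hu
  · have := hu.map (mapRingHom (evalRingHom (MvPolynomial.C (N : ℚ)⁻¹)))
    rw [coe_mapRingHom, h1] at this
    exact hgd N (natDegree_eq_zero_of_isUnit this)
  · have := hu.map (mapRingHom (evalRingHom (MvPolynomial.C (N : ℚ)⁻¹)))
    rw [coe_mapRingHom, h2] at this
    exact hhd N (natDegree_eq_zero_of_isUnit this)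

end Specialization

/-! ### Hilbert irreducibility over the rationals -/

section HilbertIrreducibility

open Polynomial

/-- A monic irreducible polynomial in characteristic zero has a nonzero discriminant. -/
theorem exists_bezout_derivative {R : Type*} [CommRing R] [IsDomain R] [IsIntegrallyClosed R]
    [CharZero R] {f : R[X]} (hf : f.Monic) (hirr : Irreducible f) :
    ∃ (p q : R[X]) (r : R), r ≠ 0 ∧ f * p + derivative f * q = C r := by
  set K := FractionRing R
  have hinj : Function.Injective (algebraMap R K) := IsFractionRing.injective R K
  have : CharZero K := charZero_of_injective_algebraMap hinj
  have hsep : (f.map (algebraMap R K)).Separable :=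
    ((hf.irreducible_iff_irreducible_map_fraction_map (K := K)).mp hirr).separable
  have hd0 : f.natDegree ≠ 0 := by
    intro h
    rw [eq_one_of_monic_natDegree_zero hf h] at hirr
    exact not_irreducible_one hirr
  -- The resultant of `f` and its derivative lies in the ideal they generate; separability over the
  -- fraction field makes it nonzero.
  obtain ⟨p, q, -, -, h⟩ := exists_mul_add_mul_eq_C_resultant f (derivative f) le_rfl le_rfl
    (Or.inl hd0)
  refine ⟨p, q, _, fun h0 => ?_, h⟩
  have h1 := resultant_ne_zero _ _ hsep
  rw [derivative_map, natDegree_map_eq_of_injective hinj, natDegree_map_eq_of_injective hinj,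
    resultant_map_map, h0, map_zero] at h1
  exact h1 rfl

/-- The points `1 / N` must approach a value of `w` where `r` does not vanish; a translation by a
rational constant moves such a value to `0`. -/
theorem exists_irreducible_specialize {σ : Type*} [Finite σ] {f : (MvPolynomial σ ℚ)[X][X]}
    (hf : f.Monic) (hirr : Irreducible f) :
    ∃ c : ℚ, Irreducible (f.map (evalRingHom (MvPolynomial.C c))) := by
  obtain ⟨p, q, r, hr, hpq⟩ := exists_bezout_derivative hf hirr
  obtain ⟨t, ht⟩ : ∃ t : ℚ, r.eval (MvPolynomial.C t) ≠ 0 := by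
    by_contra! hcon
    refine hr (eq_zero_of_infinite_isRoot r ((Set.infinite_range_of_injective
      (MvPolynomial.C_injective σ ℚ)).mono ?_))
    rintro _ ⟨t, rfl⟩
    exact hcon t
  set e : (MvPolynomial σ ℚ)[X] ≃+* (MvPolynomial σ ℚ)[X] :=
    (taylorEquiv (MvPolynomial.C t : MvPolynomial σ ℚ)).toRingEquiv with he
  have hes : ∀ (x : MvPolynomial σ ℚ) (s : (MvPolynomial σ ℚ)[X]),
      (e s).eval x = s.eval (x + MvPolynomial.C t) := fun x s => taylor_eval _ _ _
  have hirr' : Irreducible (f.map (e : (MvPolynomial σ ℚ)[X] →+* (MvPolynomial σ ℚ)[X])) :=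
    (MulEquiv.irreducible_iff (mapEquiv e)).mpr hirr
  obtain ⟨c, hc⟩ := exists_irreducible_specialize_inv (hf.map _) hirr'
    (p := p.map (e : (MvPolynomial σ ℚ)[X] →+* _)) (q := q.map (e : (MvPolynomial σ ℚ)[X] →+* _))
    (r := e r) (by
      rw [derivative_map, ← Polynomial.map_mul, ← Polynomial.map_mul, ← Polynomial.map_add, hpq,
        map_C]
      rfl)
    (by rw [hes, zero_add]; exact ht)
  refine ⟨c + t, ?_⟩
  convert hc using 1
  rw [Polynomial.map_map]
  congr 1
  refine RingHom.ext fun s => ?_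
  rw [RingHom.comp_apply, coe_evalRingHom, coe_evalRingHom, map_add]
  exact (hes _ s).symm

/-- Hilbert's irreducibility theorem over `ℚ`. -/
theorem hilbert_irreducibility (n : ℕ) {f : (MvPolynomial (Fin n) ℚ)[X]} (hf : f.Monic)
    (hirr : Irreducible f) : ∃ a : Fin n → ℚ, Irreducible (f.map (MvPolynomial.eval a)) := by
  induction n with
  | zero =>
    refine ⟨Fin.elim0, ?_⟩
    exact (MulEquiv.irreducible_iff
      (mapEquiv (MvPolynomial.isEmptyRingEquiv ℚ (Fin 0)))).mpr hirr |> fun h => by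
        convert h using 1
        exact congrArg (fun g => f.map g) (MvPolynomial.ringHom_ext' (Subsingleton.elim _ _)
          fun i => i.elim0)
  | succ n ih =>
    set e := (MvPolynomial.finSuccEquiv ℚ n).toRingEquiv with he
    have hirr' : Irreducible (f.map (e : MvPolynomial (Fin (n + 1)) ℚ →+* (MvPolynomial (Fin n) ℚ)[X])) :=
      (MulEquiv.irreducible_iff (mapEquiv e)).mpr hirr
    obtain ⟨c, hc⟩ := exists_irreducible_specialize (hf.map _) hirr'
    obtain ⟨a, ha⟩ := ih ((hf.map _).map _) hc
    refine ⟨Fin.cons c a, ?_⟩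
    convert ha using 1
    rw [Polynomial.map_map, Polynomial.map_map]
    congr 1
    ext i
    · simp [he]
    · refine Fin.cases ?_ (fun j => ?_) i <;> simp [he, MvPolynomial.finSuccEquiv_X_zero,
        MvPolynomial.finSuccEquiv_X_succ]

end HilbertIrreducibility

/-! ### Specialization of Galois extensions -/

section GaloisSpecialization

open scoped Pointwise

open Polynomial Module

/-- A nonzero multiple by an element of `A` makes a primitive element integral and keeps it
primitive. As `A` is integrally closed, its minimal polynomial over `A` is also the one over `E`. -/
theorem exists_integral_primitive_element (A E L : Type*) [CommRing A] [IsDomain A]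
    [IsIntegrallyClosed A] [CharZero A] [Field E] [Algebra A E] [IsFractionRing A E] [Field L]
    [Algebra A L] [Algebra E L] [IsScalarTower A E L] [FiniteDimensional E L] :
    ∃ θ : L, IsIntegral A θ ∧ Irreducible (minpoly A θ) ∧
      (minpoly A θ).natDegree = finrank E L := by
  have : CharZero E := charZero_of_injective_algebraMap (IsFractionRing.injective A E)
  obtain ⟨θ, hθ⟩ := Field.exists_primitive_element E L
  have halg : IsAlgebraic A θ :=
    (IsFractionRing.isAlgebraic_iff A E L).mpr (Algebra.IsAlgebraic.isAlgebraic θ)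
  obtain ⟨y, hy, hint⟩ := halg.exists_integral_multiple
  have : FaithfulSMul A L := (faithfulSMul_iff_algebraMap_injective A L).mpr (by
    rw [IsScalarTower.algebraMap_eq A E L]
    exact (algebraMap E L).injective.comp (IsFractionRing.injective A E))
  have : Module.IsTorsionFree A L := inferInstance
  have hprim : IntermediateField.adjoin E {y • θ} = ⊤ := by
    rw [eq_top_iff, ← hθ, IntermediateField.adjoin_simple_le_iff]
    have h1 : y • θ ∈ IntermediateField.adjoin E {y • θ} :=
      IntermediateField.mem_adjoin_simple_self E _
    have hy' : algebraMap A E y ≠ 0 := by simpa using hy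
    have h2 := (IntermediateField.adjoin E {y • θ}).smul_mem (x := (algebraMap A E y)⁻¹) h1
    have h3 : (algebraMap A E y)⁻¹ • (y • θ) = θ := by
      rw [← algebraMap_smul E y θ, inv_smul_smul₀ hy']
    rwa [h3] at h2
  refine ⟨y • θ, hint, (minpoly.prime_of_isIntegrallyClosed hint).irreducible, ?_⟩
  rw [(Field.primitive_element_iff_minpoly_natDegree_eq E (y • θ)).mp hprim |>.symm,
    minpoly.isIntegrallyClosed_eq_field_fractions' E hint,
    (minpoly.monic hint).natDegree_map]

/-- `K` is the residue field of the integral closure at a maximal ideal `Q` above `ker ev`. The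
decomposition group of `Q` surjects onto `Gal(K/k)`; if `K` has full degree, counting makes this
group all of `Gal(L/E)` and the surjection bijective. -/
theorem exists_galois_residue_extension {A E : Type*} {L : Type u} [CommRing A] [IsDomain A]
    [IsIntegrallyClosed A] [Field E] [Algebra A E] [IsFractionRing A E] [Field L]
    [Algebra A L] [Algebra E L] [IsScalarTower A E L] [FiniteDimensional E L] [IsGalois E L]
    {k : Type*} [Field k] [CharZero k] (ev : A →+* k) (hev : Function.Surjective ev) :
    ∃ (K : Type u) (_ : Field K) (_ : Algebra k K) (φ : integralClosure A L →+* K),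
      FiniteDimensional k K ∧ IsGalois k K ∧
      (∀ x : A, φ (algebraMap A _ x) = algebraMap k K (ev x)) ∧
      (finrank E L ≤ finrank k K → Nonempty (Gal(K/k) ≃* Gal(L/E))) := by
  let B := integralClosure A L
  let P : Ideal A := RingHom.ker ev
  have hP : P.IsMaximal := RingHom.ker_isMaximal_of_surjective ev hev
  have : IsFractionRing B L := integralClosure.isFractionRing_of_finite_extension E L
  let act : MulSemiringAction Gal(L/E) B := IsIntegralClosure.MulSemiringAction A E L B
  have hinv : Algebra.IsInvariant A B Gal(L/E) := Algebra.isInvariant_of_isGalois A E L B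
  have : SMulCommClass Gal(L/E) A B := ⟨fun g a b => by
    change galRestrict A E L B g (a • b) = a • galRestrict A E L B g b
    exact map_smul _ _ _⟩
  have : FaithfulSMul A L := (faithfulSMul_iff_algebraMap_injective A L).mpr (by
    rw [IsScalarTower.algebraMap_eq A E L]
    exact (algebraMap E L).injective.comp (IsFractionRing.injective A E))
  obtain ⟨Q, hQ, hQP⟩ := Ideal.exists_maximal_ideal_liesOver_of_isIntegral (S := B) P
  let : Field (B ⧸ Q) := Ideal.Quotient.field Q
  let ψ : A ⧸ P ≃+* k := RingHom.quotientKerEquivOfSurjective hev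
  let : Algebra (A ⧸ P) k := (ψ : A ⧸ P →+* k).toAlgebra
  have : IsFractionRing (A ⧸ P) k := by
    let : Field (A ⧸ P) := Ideal.Quotient.field P
    exact IsLocalization.isLocalization_of_algEquiv (nonZeroDivisors (A ⧸ P))
      (AlgEquiv.ofRingEquiv (f := ψ) fun x => rfl : (A ⧸ P) ≃ₐ[A ⧸ P] k)
  let : Algebra k (B ⧸ Q) := ((algebraMap (A ⧸ P) (B ⧸ Q)).comp (ψ.symm : k →+* A ⧸ P)).toAlgebra
  have : IsScalarTower (A ⧸ P) k (B ⧸ Q) := IsScalarTower.of_algebraMap_eq fun x => by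
    change _ = algebraMap (A ⧸ P) (B ⧸ Q) (ψ.symm (ψ x))
    rw [ψ.symm_apply_apply]
  have hnor : Normal k (B ⧸ Q) := Ideal.IsFractionRing.normal Gal(L/E) P Q k (B ⧸ Q)
  have : IsGalois k (B ⧸ Q) := { __ := hnor }
  have hfin : FiniteDimensional k (B ⧸ Q) :=
    Ideal.IsFractionRing.finite_of_isInvariant Gal(L/E) P Q k (B ⧸ Q)
  refine ⟨B ⧸ Q, inferInstance, inferInstance, Ideal.Quotient.mk Q, hfin, inferInstance,
    fun x => ?_, fun hle => ?_⟩
  · change algebraMap A (B ⧸ Q) x = algebraMap (A ⧸ P) (B ⧸ Q) (ψ.symm (ev x))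
    rw [show ev x = ψ (Ideal.Quotient.mk P x) from rfl, ψ.symm_apply_apply]
    rfl
  · have hsurj := IsFractionRing.stabilizerHom_surjective Gal(L/E) P Q k (B ⧸ Q)
    rw [← IsGalois.card_aut_eq_finrank, ← IsGalois.card_aut_eq_finrank] at hle
    have hbot := Nat.card_le_card_of_surjective _ hsurj
    have htop : MulAction.stabilizer Gal(L/E) Q = ⊤ :=
      Subgroup.eq_top_of_le_card _ (hle.trans hbot)
    have hcard : Nat.card (MulAction.stabilizer Gal(L/E) Q) = Nat.card Gal((B ⧸ Q)/k) := by
      refine le_antisymm ?_ hbot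
      rw [htop, Subgroup.card_top]
      exact hle
    have hbij := (Nat.bijective_iff_surjective_and_card _).mpr ⟨hsurj, hcard⟩
    exact ⟨((MulEquiv.ofBijective _ hbij).symm.trans (MulEquiv.subgroupCongr htop)).trans
      Subgroup.topEquiv⟩

attribute [local instance] MvPolynomial.algebraMvPolynomial

/-- Irreducibility over `ℚ` suffices for `k` if the primitive element `θ` generates `L` over `E₀`
rather than over `E`. Its image in `K` has degree `[L : E₀]` over `ℚ`, so `[K : ℚ] ≥ [L : E₀]`;
dividing by `[k : ℚ] = [E : E₀]` gives `[K : k] ≥ [L : E]`. -/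
theorem exists_galois_of_galois_fractionRing_aux (k : Type u) [Field k] [NumberField k] (n : ℕ)
    (E₀ E : Type*) (L : Type u) [Field E₀] [Field E] [Field L]
    [Algebra (MvPolynomial (Fin n) ℚ) E₀]
    [IsFractionRing (MvPolynomial (Fin n) ℚ) E₀] [Algebra (MvPolynomial (Fin n) k) E]
    [IsFractionRing (MvPolynomial (Fin n) k) E] [Algebra E₀ E] [Algebra E L] [Algebra E₀ L]
    [Algebra (MvPolynomial (Fin n) ℚ) L] [Algebra (MvPolynomial (Fin n) k) L]
    [IsScalarTower E₀ E L] [IsScalarTower (MvPolynomial (Fin n) ℚ) E₀ L]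
    [IsScalarTower (MvPolynomial (Fin n) k) E L]
    [IsScalarTower (MvPolynomial (Fin n) ℚ) (MvPolynomial (Fin n) k) L]
    (hrank : finrank E₀ E = finrank ℚ k) [FiniteDimensional E L] [IsGalois E L] :
    ∃ (K : Type u) (_ : Field K) (_ : Algebra k K), FiniteDimensional k K ∧ IsGalois k K ∧
      Nonempty (Gal(K/k) ≃* Gal(L/E)) := by
  have : FiniteDimensional E₀ E := Module.finite_of_finrank_pos (by
    rw [hrank]; exact finrank_pos)
  have : FiniteDimensional E₀ L := FiniteDimensional.trans E₀ E L
  obtain ⟨θ, hθint, hθirr, hθdeg⟩ :=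
    exists_integral_primitive_element (MvPolynomial (Fin n) ℚ) E₀ L
  obtain ⟨a, ha⟩ := hilbert_irreducibility n (minpoly.monic hθint) hθirr
  have hev : Function.Surjective (MvPolynomial.eval (fun i => (a i : k))) :=
    fun c => ⟨MvPolynomial.C c, by simp⟩
  obtain ⟨K, _, _, φ, hfin, hgal, hφ, hiso⟩ := exists_galois_residue_extension (E := E) (L := L)
    _ hev
  refine ⟨K, inferInstance, inferInstance, hfin, hgal, hiso ?_⟩
  let θB : integralClosure (MvPolynomial (Fin n) k) L := ⟨θ, hθint.tower_top⟩
  have hK : CharZero K := charZero_of_injective_algebraMap (algebraMap k K).injective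
  set f := minpoly (MvPolynomial (Fin n) ℚ) θ with hf
  have hroot : (f.map (MvPolynomial.eval a)).aeval (φ θB) = 0 := by
    have h0 : f.eval₂ ((algebraMap (MvPolynomial (Fin n) k) (integralClosure _ L)).comp
        (algebraMap (MvPolynomial (Fin n) ℚ) (MvPolynomial (Fin n) k))) θB = 0 := by
      apply Subtype.val_injective
      have h := minpoly.aeval (MvPolynomial (Fin n) ℚ) θ
      rw [aeval_def, IsScalarTower.algebraMap_eq (MvPolynomial (Fin n) ℚ) (MvPolynomial (Fin n) k)
        L] at h
      exact (hom_eval₂ _ _ (integralClosure (MvPolynomial (Fin n) k) L).val.toRingHom _).trans h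
    have h1 : (algebraMap ℚ K).comp (MvPolynomial.eval a) =
        φ.comp ((algebraMap (MvPolynomial (Fin n) k) (integralClosure _ L)).comp
        (algebraMap (MvPolynomial (Fin n) ℚ) (MvPolynomial (Fin n) k))) := by
      refine MvPolynomial.ringHom_ext (fun r => ?_) fun i => ?_
      · rw [RingHom.comp_apply, RingHom.comp_apply, RingHom.comp_apply, hφ]
        simp
      · rw [RingHom.comp_apply, RingHom.comp_apply, RingHom.comp_apply, hφ]
        simp
    rw [aeval_def, eval₂_map, h1, ← hom_eval₂, h0, map_zero]
  have hmin : f.map (MvPolynomial.eval a) = minpoly ℚ (φ θB) :=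
    minpoly.eq_of_irreducible_of_monic ha hroot ((minpoly.monic hθint).map _)
  have : FiniteDimensional ℚ K := FiniteDimensional.trans ℚ k K
  have hdeg : finrank E₀ L ≤ finrank ℚ K := by
    rw [← hθdeg, ← (minpoly.monic hθint).natDegree_map (MvPolynomial.eval a), hmin]
    exact minpoly.natDegree_le _
  rw [← finrank_mul_finrank E₀ E L, ← finrank_mul_finrank ℚ k K, hrank] at hdeg
  exact Nat.le_of_mul_le_mul_left hdeg finrank_pos

attribute [local instance] FractionRing.liftAlgebra

/-- A finite Galois extension of `k(t₁, …, tₙ)` specializes to a Galois extension of the number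
field `k` with the same group. -/
theorem exists_galois_of_galois_fractionRing (k : Type u) [Field k] [NumberField k] (n : ℕ)
    (L : Type u) [Field L] [Algebra (FractionRing (MvPolynomial (Fin n) k)) L]
    [FiniteDimensional (FractionRing (MvPolynomial (Fin n) k)) L]
    [IsGalois (FractionRing (MvPolynomial (Fin n) k)) L] :
    ∃ (K : Type u) (_ : Field K) (_ : Algebra k K), FiniteDimensional k K ∧ IsGalois k K ∧
      Nonempty (Gal(K/k) ≃* Gal(L/FractionRing (MvPolynomial (Fin n) k))) := by
  have hrank : finrank (FractionRing (MvPolynomial (Fin n) ℚ))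
      (FractionRing (MvPolynomial (Fin n) k)) = finrank ℚ k := by
    have := Algebra.IsAlgebraic.rank_fractionRing_mvPolynomial (R := ℚ) (S := k) (Fin n)
    rw [finrank, this]
    simp [finrank]
  let i1 : Algebra (MvPolynomial (Fin n) k) L := ((algebraMap (FractionRing
    (MvPolynomial (Fin n) k)) L).comp (algebraMap (MvPolynomial (Fin n) k) _)).toAlgebra
  let i2 : Algebra (FractionRing (MvPolynomial (Fin n) ℚ)) L := ((algebraMap (FractionRing
    (MvPolynomial (Fin n) k)) L).comp (algebraMap (FractionRing (MvPolynomial (Fin n) ℚ))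
    (FractionRing (MvPolynomial (Fin n) k)))).toAlgebra
  let i3 : Algebra (MvPolynomial (Fin n) ℚ) L := ((algebraMap (MvPolynomial (Fin n) k) L).comp
    (algebraMap (MvPolynomial (Fin n) ℚ) (MvPolynomial (Fin n) k))).toAlgebra
  have t1 : IsScalarTower (MvPolynomial (Fin n) k) (FractionRing (MvPolynomial (Fin n) k)) L :=
    IsScalarTower.of_algebraMap_eq fun _ => rfl
  have t2 : IsScalarTower (FractionRing (MvPolynomial (Fin n) ℚ))
    (FractionRing (MvPolynomial (Fin n) k)) L := IsScalarTower.of_algebraMap_eq fun _ => rfl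
  have t3 : IsScalarTower (MvPolynomial (Fin n) ℚ) (MvPolynomial (Fin n) k) L :=
    IsScalarTower.of_algebraMap_eq fun _ => rfl
  have t4 : IsScalarTower (MvPolynomial (Fin n) ℚ) (FractionRing (MvPolynomial (Fin n) ℚ)) L :=
    IsScalarTower.of_algebraMap_eq fun x => congrArg (algebraMap _ L)
      ((IsScalarTower.algebraMap_apply (MvPolynomial (Fin n) ℚ) (MvPolynomial (Fin n) k)
        (FractionRing (MvPolynomial (Fin n) k)) x).symm.trans
      (IsScalarTower.algebraMap_apply (MvPolynomial (Fin n) ℚ)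
        (FractionRing (MvPolynomial (Fin n) ℚ)) (FractionRing (MvPolynomial (Fin n) k)) x))
  exact exists_galois_of_galois_fractionRing_aux k n (FractionRing (MvPolynomial (Fin n) ℚ))
    (FractionRing (MvPolynomial (Fin n) k)) L hrank

end GaloisSpecialization

/-! ### Homogeneous coordinates of points of projective space -/

noncomputable section ProjectiveCoordinates

open MvPolynomial HomogeneousLocalization

attribute [local instance] MvPolynomial.gradedAlgebra

variable {k : Type u} [Field k] {ι : Type}

theorem eval₂_smul_of_isHomogeneous {R S : Type*} [CommSemiring R] [CommSemiring S] {s : R →+* S}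
    {c : ι → S} {u : S} {p : MvPolynomial ι R} {n : ℕ} (hp : p.IsHomogeneous n) :
    eval₂ s (fun i => u * c i) p = u ^ n * eval₂ s c p := by
  rw [eval₂_eq, eval₂_eq, Finset.mul_sum]
  refine Finset.sum_congr rfl fun d hd => ?_
  have hdeg := hp (mem_support_iff.mp hd)
  simp_rw [mul_pow, Finset.prod_mul_distrib, Finset.prod_pow_eq_pow_sum]
  rw [Finsupp.weight_apply] at hdeg
  simp only [Finsupp.sum, Pi.one_apply, smul_eq_mul, mul_one] at hdeg
  rw [hdeg]
  ring

/-- Evaluation at `c` of the fractions with denominator a power of `f`. -/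
def localizationEval {R : Type*} [CommRing R] (s : k →+* R) (c : ι → R) (f : MvPolynomial ι k)
    (hf : IsUnit (eval₂ s c f)) : Localization.Away f →+* R :=
  IsLocalization.Away.lift f (g := eval₂Hom s c) hf

/-- Evaluation at `c` of the homogeneous fractions with denominator a power of `f`. -/
def awayEval {R : Type*} [CommRing R] (s : k →+* R) (c : ι → R) (f : MvPolynomial ι k)
    (hf : IsUnit (eval₂ s c f)) : Away (homogeneousSubmodule ι k) f →+* R :=
  (localizationEval s c f hf).comp
    (algebraMap (Away (homogeneousSubmodule ι k) f) (Localization.Away f))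

section

variable {R : Type*} [CommRing R] {s : k →+* R} {c : ι → R} {f : MvPolynomial ι k}
  {hf : IsUnit (eval₂ s c f)}

theorem localizationEval_algebraMap (p : MvPolynomial ι k) :
    localizationEval s c f hf (algebraMap _ _ p) = eval₂ s c p :=
  IsLocalization.Away.lift_eq (S := Localization.Away f) f (g := eval₂Hom s c) hf p

theorem localization_ringHom_ext {φ ψ : Localization.Away f →+* R}
    (h : ∀ p : MvPolynomial ι k, φ (algebraMap _ _ p) = ψ (algebraMap _ _ p)) : φ = ψ :=
  IsLocalization.ringHom_ext (Submonoid.powers f) (RingHom.ext h)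

theorem awayEval_apply (z : Away (homogeneousSubmodule ι k) f) :
    awayEval s c f hf z = localizationEval s c f hf z.val := rfl

theorem awayEval_mk {m : ℕ} (hfm : f ∈ homogeneousSubmodule ι k m) (n : ℕ) (p : MvPolynomial ι k)
    (hp : p ∈ homogeneousSubmodule ι k (n • m)) :
    awayEval s c f hf (Away.mk _ hfm n p hp) * eval₂ s c f ^ n = eval₂ s c p := by
  rw [awayEval_apply, Away.val_mk, Localization.mk_eq_mk']
  have h := IsLocalization.mk'_spec (Localization.Away f) p (⟨f ^ n, n, rfl⟩ : Submonoid.powers f)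
  have h2 := congrArg (localizationEval s c f hf) h
  rw [map_mul, localizationEval_algebraMap, localizationEval_algebraMap] at h2
  have h3 : eval₂ s c (f ^ n) = eval₂ s c f ^ n := map_pow (eval₂Hom s c) f n
  exact (congrArg _ h3.symm).trans h2

theorem eq_awayEval {m : ℕ} (hfm : f ∈ homogeneousSubmodule ι k m)
    (φ : Away (homogeneousSubmodule ι k) f →+* R)
    (h : ∀ (n : ℕ) (p : MvPolynomial ι k) (hp : p ∈ homogeneousSubmodule ι k (n • m)),
      φ (Away.mk _ hfm n p hp) * eval₂ s c f ^ n = eval₂ s c p) : φ = awayEval s c f hf := by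
  ext z
  obtain ⟨n, p, hp, rfl⟩ := Away.mk_surjective _ hfm z
  exact (hf.pow n).mul_right_cancel ((h n p hp).trans (awayEval_mk hfm n p hp).symm)

theorem isUnit_eval₂_comp {R' : Type*} [CommRing R'] (φ : R →+* R')
    (hf : IsUnit (eval₂ s c f)) : IsUnit (eval₂ (φ.comp s) (φ ∘ c) f) := by
  have h := hf.map φ
  rwa [hom_eval₂] at h

theorem comp_awayEval {R' : Type*} [CommRing R'] (φ : R →+* R')
    (hf' : IsUnit (eval₂ (φ.comp s) (φ ∘ c) f)) :
    φ.comp (awayEval s c f hf) = awayEval (φ.comp s) (φ ∘ c) f hf' := by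
  rw [awayEval, awayEval, ← RingHom.comp_assoc]
  congr 1
  refine localization_ringHom_ext fun p => ?_
  rw [RingHom.comp_apply, localizationEval_algebraMap, localizationEval_algebraMap, hom_eval₂]
  rfl

theorem awayEval_comp_awayMap {m : ℕ} {g : MvPolynomial ι k}
    (hg : g ∈ homogeneousSubmodule ι k m) {x : MvPolynomial ι k} (hx : x = f * g)
    (hfg : IsUnit (eval₂ s c x)) :
    (awayEval s c x hfg).comp (awayMap _ hg hx) = awayEval s c f hf := by
  ext z
  rw [RingHom.comp_apply, awayEval_apply, awayEval_apply, val_awayMap, ← RingHom.comp_apply]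
  congr 1
  refine localization_ringHom_ext fun p => ?_
  rw [RingHom.comp_apply, localizationEval_algebraMap, Localization.awayLift,
    IsLocalization.Away.lift_eq, localizationEval_algebraMap]

theorem eval₂_smul_unit {m : ℕ} (hfm : f ∈ homogeneousSubmodule ι k m) (u : Rˣ)
    (hf : IsUnit (eval₂ s c f)) : IsUnit (eval₂ s (fun i => u * c i) f) := by
  rw [eval₂_smul_of_isHomogeneous hfm]
  exact (u.isUnit.pow m).mul hf

theorem awayEval_smul {m : ℕ} (hfm : f ∈ homogeneousSubmodule ι k m) (u : Rˣ)
    (hf' : IsUnit (eval₂ s (fun i => u * c i) f)) :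
    awayEval s (fun i => u * c i) f hf' = awayEval s c f hf := by
  refine eq_awayEval hfm _ fun n p hp => ?_
  have h := awayEval_mk (hf := hf') hfm n p hp
  rw [eval₂_smul_of_isHomogeneous hfm, eval₂_smul_of_isHomogeneous hp, mul_pow, ← pow_mul,
    mul_comm m n, smul_eq_mul] at h
  refine (u.isUnit.pow (n * m)).mul_left_cancel ?_
  rw [← h]
  ring

theorem X_mem (j : ι) : (X j : MvPolynomial ι k) ∈ homogeneousSubmodule ι k 1 :=
  isHomogeneous_X k j

theorem X_mem' (j : ι) : (X j : MvPolynomial ι k) ∈ homogeneousSubmodule ι k (1 • 1) :=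
  isHomogeneous_X k j

/-- Every ring homomorphism from the degree zero fractions with denominators powers of `X j` is
an evaluation. -/
theorem exists_eq_awayEval (j : ι) (φ : Away (homogeneousSubmodule ι k) (X j) →+* R) :
    ∃ (s : k →+* R) (c : ι → R) (hc : IsUnit (eval₂ s c (X j))), φ = awayEval s c (X j) hc := by
  let s₀ : k →+* Away (homogeneousSubmodule ι k) (X j) :=
    (fromZeroRingHom (homogeneousSubmodule ι k) _).comp
      (algebraMap k (homogeneousSubmodule ι k 0))
  let c₀ : ι → Away (homogeneousSubmodule ι k) (X j) := fun i =>
    Away.mk _ (X_mem j) 1 (X i) (X_mem' i)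
  -- By homogeneity, `p / X j ^ n` is the value of `p` at the fractions `X i / X j`.
  have hval : ∀ (n : ℕ) (p : MvPolynomial ι k) (hp : p ∈ homogeneousSubmodule ι k (n • 1)),
      Away.mk _ (X_mem j) n p hp = eval₂ s₀ c₀ p := by
    intro n p hp
    apply HomogeneousLocalization.val_injective
    have hu : IsUnit (algebraMap (MvPolynomial ι k) (Localization.Away (X j)) (X j)) :=
      IsLocalization.Away.algebraMap_isUnit (S := Localization.Away (X j : MvPolynomial ι k)) (X j)
    have h1 : (fun i => algebraMap (MvPolynomial ι k) (Localization.Away (X j)) (X i)) =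
        fun i => (algebraMap (MvPolynomial ι k) (Localization.Away (X j)) (X j)) *
          (c₀ i).val := by
      funext i
      rw [Away.val_mk, mul_comm, Localization.mk_eq_mk']
      have h := IsLocalization.mk'_spec (Localization.Away (X j : MvPolynomial ι k)) (X i)
        (⟨X j ^ 1, 1, rfl⟩ : Submonoid.powers (X j : MvPolynomial ι k))
      rw [← h]
      simp
    have h2 : algebraMap (MvPolynomial ι k) (Localization.Away (X j : MvPolynomial ι k)) p =
        eval₂ ((algebraMap (MvPolynomial ι k) (Localization.Away (X j : MvPolynomial ι k))).comp C)
          (fun i => algebraMap (MvPolynomial ι k) (Localization.Away (X j)) (X i)) p := by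
      conv_lhs => rw [← eval₂_eta p]
      exact hom_eval₂ _ _ _ _
    have hp' : p.IsHomogeneous n := by simpa using hp
    rw [h1, eval₂_smul_of_isHomogeneous hp'] at h2
    refine (hu.pow n).mul_left_cancel ?_
    rw [Away.val_mk, Localization.mk_eq_mk', mul_comm]
    have h := IsLocalization.mk'_spec (Localization.Away (X j : MvPolynomial ι k)) p
        (⟨X j ^ n, n, rfl⟩ : Submonoid.powers (X j : MvPolynomial ι k))
    rw [map_pow] at h
    rw [h, h2]
    congr 1
    have h3 : (algebraMap (MvPolynomial ι k) (Localization.Away (X j : MvPolynomial ι k))).comp C =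
        (algebraMap (Away (homogeneousSubmodule ι k) (X j))
          (Localization.Away (X j : MvPolynomial ι k))).comp s₀ :=
      RingHom.ext fun a => (Localization.mk_one_eq_algebraMap _).symm
    rw [h3, ← HomogeneousLocalization.algebraMap_apply, hom_eval₂]
    rfl
  have hj : φ (c₀ j) = 1 := by
    have : c₀ j = 1 := by
      apply HomogeneousLocalization.val_injective
      rw [Away.val_mk, val_one]
      simp
    rw [this, map_one]
  refine ⟨φ.comp s₀, φ ∘ c₀, by simp [hj], eq_awayEval (X_mem j) _ fun n p hp => ?_⟩
  rw [hval, eval₂_X, Function.comp_apply, hj, one_pow, mul_one]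
  exact hom_eval₂ _ _ _ _

end

/-- The projective space over `k` with homogeneous coordinates indexed by `ι`. -/
abbrev projectiveSpaceOf (k : Type u) [Field k] (ι : Type) : Scheme.{u} :=
  Proj (homogeneousSubmodule ι k)

/-- The structure morphism of `projectiveSpaceOf k ι`. -/
def projectiveSpaceOfHom (k : Type u) [Field k] (ι : Type) :
    projectiveSpaceOf k ι ⟶ Spec (CommRingCat.of k) :=
  Proj.toSpecZero (homogeneousSubmodule ι k) ≫
    Spec.map (CommRingCat.ofHom (algebraMap k (homogeneousSubmodule ι k 0)))

/-- The `R`-valued point of projective space with homogeneous coordinates `c`, one of which, `c j`,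
is a unit. -/
def coordPoint {R : CommRingCat.{u}} (s : k →+* R) (c : ι → R) (f : MvPolynomial ι k) {m : ℕ}
    (hf : f ∈ homogeneousSubmodule ι k m) (hm : 0 < m) (hc : IsUnit (eval₂ s c f)) :
    Spec R ⟶ projectiveSpaceOf k ι :=
  Spec.map (CommRingCat.ofHom (awayEval s c f hc)) ≫ Proj.awayι _ f hf hm

/-- `y` is the point of projective space with homogeneous coordinates `c`. -/
def HasCoords {R : CommRingCat.{u}} (y : Spec R ⟶ projectiveSpaceOf k ι) (s : k →+* R)
    (c : ι → R) : Prop :=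
  ∃ (j : ι) (hc : IsUnit (eval₂ s c (X j))), y = coordPoint s c (X j) (X_mem j) one_pos hc

section

variable {R : CommRingCat.{u}} {s : k →+* R} {c : ι → R} {y : Spec R ⟶ projectiveSpaceOf k ι}

/-- The chart of `f * g` is contained in that of `f`, so descriptions of a point in two charts can
be compared in the chart of the product. -/
theorem coordPoint_mul {f g : MvPolynomial ι k} {m m' : ℕ} (hf : f ∈ homogeneousSubmodule ι k m)
    (hm : 0 < m) (hg : g ∈ homogeneousSubmodule ι k m') {x : MvPolynomial ι k} (hx : x = f * g)
    (hxm : x ∈ homogeneousSubmodule ι k (m + m'))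
    (hc : IsUnit (eval₂ s c f)) (hc' : IsUnit (eval₂ s c x)) :
    coordPoint s c x hxm (Nat.add_pos_left hm _) hc' = coordPoint s c f hf hm hc := by
  rw [coordPoint, coordPoint, ← Proj.SpecMap_awayMap_awayι _ hf hm hg hx, ← Category.assoc,
    ← Spec.map_comp, ← CommRingCat.ofHom_comp, awayEval_comp_awayMap]

theorem HasCoords.eq_coordPoint (h : HasCoords y s c) (j : ι) (hc : IsUnit (c j)) :
    y = coordPoint s c (X j) (X_mem j) one_pos (by simpa using hc) := by
  obtain ⟨l, hl, rfl⟩ := h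
  have hj : IsUnit (eval₂ s c (X j)) := by simpa using hc
  have hu : IsUnit (eval₂ s c (X l * X j)) := by simpa using hl.mul hj
  have h2 : (X l * X j : MvPolynomial ι k) ∈ homogeneousSubmodule ι k (1 + 1) :=
    SetLike.mul_mem_graded (X_mem l) (X_mem j)
  rw [← coordPoint_mul (X_mem l) one_pos (X_mem j) rfl h2 hl hu,
    ← coordPoint_mul (X_mem j) one_pos (X_mem l) (mul_comm _ _) h2 hj hu]

theorem HasCoords.unique {y' : Spec R ⟶ projectiveSpaceOf k ι} (h : HasCoords y s c)
    (h' : HasCoords y' s c) : y = y' := by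
  obtain ⟨j, hj, rfl⟩ := id h'
  exact h.eq_coordPoint j (by simpa using hj)

theorem HasCoords.smul (h : HasCoords y s c) (u : Rˣ) : HasCoords y s (fun i => u * c i) := by
  obtain ⟨j, hj, rfl⟩ := h
  refine ⟨j, eval₂_smul_unit (X_mem j) u hj, ?_⟩
  rw [coordPoint, coordPoint, awayEval_smul (hf := hj) (X_mem j)]

theorem HasCoords.comp {R' : CommRingCat.{u}} (h : HasCoords y s c) (φ : R ⟶ R') :
    HasCoords (Spec.map φ ≫ y) (φ.hom.comp s) (φ.hom ∘ c) := by
  obtain ⟨j, hj, rfl⟩ := h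
  refine ⟨j, isUnit_eval₂_comp φ.hom hj, ?_⟩
  rw [coordPoint, coordPoint, ← comp_awayEval (hf := hj), CommRingCat.ofHom_comp, Spec.map_comp,
    Category.assoc]
  rfl

theorem HasCoords.comp_hom (h : HasCoords y s c) :
    y ≫ projectiveSpaceOfHom k ι = Spec.map (CommRingCat.ofHom s) := by
  obtain ⟨j, hj, rfl⟩ := h
  rw [coordPoint, projectiveSpaceOfHom, Category.assoc, Proj.awayι_toSpecZero_assoc,
    ← Spec.map_comp, ← Spec.map_comp, ← CommRingCat.ofHom_comp, ← CommRingCat.ofHom_comp]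
  congr 2
  ext a
  rw [RingHom.comp_apply, RingHom.comp_apply, awayEval_apply]
  change localizationEval s c (X j) hj (Localization.mk (C a) 1) = s a
  rw [Localization.mk_one_eq_algebraMap, localizationEval_algebraMap, eval₂_C]

/-- The point lies in the chart of `X j`, so `c' j` is a unit as well. In that chart a point is
determined by the ratios of its coordinates to the `j`-th, and these agree for `c` and `c'`. -/
theorem HasCoords.exists_unit {c' : ι → R} (h : HasCoords y s c) (h' : HasCoords y s c') :
    ∃ u : Rˣ, ∀ i, c' i = u * c i := by
  obtain ⟨j, hj, hy⟩ := h
  obtain ⟨l, hl, hy'⟩ := id h'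
  have hj' : IsUnit (c' j) := by
    have h1 : y ⁻¹ᵁ Proj.basicOpen (homogeneousSubmodule ι k) (X j) = ⊤ := by
      rw [hy, coordPoint, ← Proj.opensRange_awayι _ _ (X_mem j) one_pos, Scheme.Hom.comp_preimage,
        Scheme.Hom.preimage_opensRange]
      rfl
    rw [hy', coordPoint, Scheme.Hom.comp_preimage,
      Proj.awayι_preimage_basicOpen _ (X_mem l) one_pos (X_mem j) one_pos] at h1
    have h2 : IsUnit (awayEval s c' (X l) hl (Away.isLocalizationElem (X_mem l) (X_mem j))) := by
      by_contra hn
      obtain ⟨M, hM, hmem⟩ := exists_max_ideal_of_mem_nonunits hn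
      have h2 : (⟨M, hM.isPrime⟩ : PrimeSpectrum R) ∈ (⊤ : (Spec R).Opens) := trivial
      rw [← h1] at h2
      exact h2 hmem
    have h3 := awayEval_mk (hf := hl) (X_mem l) 1 (X j) (X_mem' j)
    rw [eval₂_X, eval₂_X, pow_one] at h3
    rw [← h3]
    refine IsUnit.mul ?_ (by simpa using hl)
    convert h2 using 2
    simp [Away.isLocalizationElem]
  have hy'' := h'.eq_coordPoint j hj'
  rw [hy, coordPoint, coordPoint, cancel_mono] at hy''
  have hmap : awayEval s c (X j) hj = awayEval s c' (X j) (by simpa using hj') :=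
    congrArg CommRingCat.Hom.hom (Spec.map_injective hy'')
  have hjc : IsUnit (c j) := by simpa using hj
  refine ⟨hj'.unit * hjc.unit⁻¹, fun i => ?_⟩
  have h1 := awayEval_mk (hf := hj) (X_mem j) 1 (X i) (X_mem' i)
  have h2 := awayEval_mk (s := s) (hf := (by simpa using hj')) (X_mem j) 1 (X i) (X_mem' i) (c := c')
  rw [← hmap] at h2
  simp only [eval₂_X, pow_one] at h1 h2
  rw [← h2, ← h1, Units.val_mul, IsUnit.unit_spec]
  have h3 : ((hjc.unit⁻¹ : Rˣ) : R) * c j = 1 := hjc.val_inv_mul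
  linear_combination (-c' j * awayEval s c (X j) hj (Away.mk _ (X_mem j) 1 (X i) (X_mem' i))) * h3

theorem exists_hasCoords (y : Spec R ⟶ projectiveSpaceOf k ι) (j : ι)
    (hy : Set.range y ⊆ Proj.basicOpen (homogeneousSubmodule ι k) (X j)) :
    ∃ (s : k →+* R) (c : ι → R), HasCoords y s c ∧ IsUnit (c j) := by
  have h : Set.range y ⊆ Set.range (Proj.awayι (homogeneousSubmodule ι k) (X j) (X_mem j) one_pos) := by
    refine hy.trans_eq ?_
    rw [← Proj.opensRange_awayι _ _ (X_mem j) one_pos]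
    rfl
  obtain ⟨s, c, hc, hφ⟩ := exists_eq_awayEval j
    (Spec.preimage (IsOpenImmersion.lift (Proj.awayι _ _ (X_mem j) one_pos) y h)).hom
  refine ⟨s, c, ⟨j, hc, ?_⟩, by simpa using hc⟩
  rw [coordPoint, ← hφ, CommRingCat.ofHom_hom, Spec.map_preimage, IsOpenImmersion.lift_fac]

theorem exists_mem_basicOpen_X (p : projectiveSpaceOf k ι) :
    ∃ j, p ∈ Proj.basicOpen (homogeneousSubmodule ι k) (X j) := by
  have h := Proj.iSup_basicOpen_eq_top' (homogeneousSubmodule ι k) (fun j => X j)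
    (fun j => ⟨1, X_mem j⟩) ?_
  · simpa using h.ge (Set.mem_univ p)
  · rw [eq_top_iff]
    rintro q -
    induction q using MvPolynomial.induction_on with
    | C a => exact Subalgebra.algebraMap_mem _ (⟨C a, isHomogeneous_C _ a⟩ : homogeneousSubmodule ι k 0)
    | add p q hp hq => exact add_mem hp hq
    | mul_X p i hp => exact mul_mem hp (Algebra.subset_adjoin ⟨i, rfl⟩)

end

theorem algebraMap_zero_surjective :
    Function.Surjective (algebraMap k (homogeneousSubmodule ι k 0)) := by
  rintro ⟨p, hp⟩
  obtain ⟨a, rfl⟩ : ∃ a, p = C a :=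
    ⟨coeff 0 p, totalDegree_eq_zero_iff_eq_C.mp (Nat.le_zero.mp hp.totalDegree_le)⟩
  exact ⟨a, rfl⟩

/-- This makes projective space an admissible target for the universal property of the quotient. -/
theorem isVariety_projectiveSpaceOf (k : Type u) [Field k] (ι : Type) [Finite ι] :
    IsVariety (Over.mk (projectiveSpaceOfHom k ι)) := by
  have : IsScalarTower k (homogeneousSubmodule ι k 0) (MvPolynomial ι k) :=
    ⟨fun a b c => smul_mul_assoc a (b : MvPolynomial ι k) c⟩
  have : Algebra.FiniteType (homogeneousSubmodule ι k 0) (MvPolynomial ι k) :=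
    Algebra.FiniteType.of_restrictScalars_finiteType k _ _
  have : IsClosedImmersion (Spec.map (CommRingCat.ofHom
      (algebraMap k (homogeneousSubmodule ι k 0)))) :=
    IsClosedImmersion.spec_of_surjective _ algebraMap_zero_surjective
  exact ⟨by dsimp [projectiveSpaceOfHom]; infer_instance,
    by dsimp [projectiveSpaceOfHom]; infer_instance,
    by dsimp [projectiveSpaceOfHom]; infer_instance⟩

end ProjectiveCoordinates

/-! ### Morphisms defined on points -/

section Gluing

open Limits

/-- Gluing of morphisms from a description of their values on `R`-valued points: `P y z` says
that the morphism maps the point `y` to the point `z`. -/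
theorem exists_hom_of_points {Y Z : Scheme.{u}}
    (P : ∀ ⦃R : CommRingCat.{u}⦄, (Spec R ⟶ Y) → (Spec R ⟶ Z) → Prop)
    (hcomp : ∀ {R S : CommRingCat.{u}} (φ : R ⟶ S) (y : Spec R ⟶ Y) (z : Spec R ⟶ Z),
      P y z → P (Spec.map φ ≫ y) (Spec.map φ ≫ z))
    (huniq : ∀ {R : CommRingCat.{u}} (y : Spec R ⟶ Y) (z z' : Spec R ⟶ Z), P y z → P y z' → z = z')
    (hloc : ∀ t : Y, ∃ (R : CommRingCat.{u}) (y : Spec R ⟶ Y) (z : Spec R ⟶ Z),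
      IsOpenImmersion y ∧ t ∈ Set.range y ∧ P y z) :
    ∃ c : Y ⟶ Z, ∀ {R : CommRingCat.{u}} (y : Spec R ⟶ Y) (z : Spec R ⟶ Z), P y z → y ≫ c = z := by
  choose R y z hy ht hP using hloc
  have hcomp' : ∀ {R S : CommRingCat.{u}} (w : Spec S ⟶ Spec R) (y : Spec R ⟶ Y)
      (z : Spec R ⟶ Z), P y z → P (w ≫ y) (w ≫ z) := by
    intro R S w y z h
    rw [← Spec.map_preimage w]
    exact hcomp _ _ _ h
  have haff : ∀ {R₁ R₂ S : CommRingCat.{u}} (y₁ : Spec R₁ ⟶ Y) (y₂ : Spec R₂ ⟶ Y)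
      (z₁ : Spec R₁ ⟶ Z) (z₂ : Spec R₂ ⟶ Z) (a : Spec S ⟶ Spec R₁) (b : Spec S ⟶ Spec R₂),
      P y₁ z₁ → P y₂ z₂ → a ≫ y₁ = b ≫ y₂ → a ≫ z₁ = b ≫ z₂ := by
    intro R₁ R₂ S y₁ y₂ z₁ z₂ a b h₁ h₂ hab
    have h₁' := hcomp' a y₁ z₁ h₁
    rw [hab] at h₁'
    exact huniq _ _ _ h₁' (hcomp' b y₂ z₂ h₂)
  have hpull : ∀ {R₁ R₂ : CommRingCat.{u}} {T : Scheme.{u}} (y₁ : Spec R₁ ⟶ Y) (y₂ : Spec R₂ ⟶ Y)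
      (z₁ : Spec R₁ ⟶ Z) (z₂ : Spec R₂ ⟶ Z) (a : T ⟶ Spec R₁) (b : T ⟶ Spec R₂), P y₁ z₁ → P y₂ z₂ →
      a ≫ y₁ = b ≫ y₂ → a ≫ z₁ = b ≫ z₂ := by
    intro R₁ R₂ T y₁ y₂ z₁ z₂ a b h₁ h₂ hab
    refine Scheme.Cover.hom_ext T.affineCover _ _ fun i => ?_
    have h := haff y₁ y₂ z₁ z₂ (T.affineCover.f i ≫ a) (T.affineCover.f i ≫ b) h₁ h₂
      ((Category.assoc _ _ _).trans ((congrArg _ hab).trans (Category.assoc _ _ _).symm))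
    exact (Category.assoc _ _ _).symm.trans (h.trans (Category.assoc _ _ _))
  let 𝒰 : Y.AffineOpenCover :=
    { I₀ := Y, X := R, f := y, idx := id, covers := ht, map_prop := hy }
  let c : Y ⟶ Z := 𝒰.openCover.glueMorphisms z fun i j =>
    hpull _ _ _ _ _ _ (hP i) (hP j) pullback.condition
  have hc : ∀ i, y i ≫ c = z i := fun i => 𝒰.openCover.ι_glueMorphisms _ _ i
  refine ⟨c, fun {S} w v h => ?_⟩
  refine Scheme.Cover.hom_ext (𝒰.openCover.pullback₁ w) _ _ fun i => ?_
  change pullback.fst w (y i) ≫ w ≫ c = pullback.fst w (y i) ≫ v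
  exact (pullback.condition_assoc _).trans ((congrArg (pullback.snd w (y i) ≫ ·) (hc i)).trans
    (hpull _ _ _ _ _ _ h (hP i) pullback.condition).symm)

end Gluing

/-! ### Chow forms and the invariant morphism -/

noncomputable section ChowForms

open MvPolynomial

variable {G : Type v} [Fintype G] {ι : Type} [Fintype ι]

/-- The product of the linear forms with coefficients `F g`. -/
def chowForm {R : Type*} [CommRing R] (F : G → ι → R) : MvPolynomial ι R :=
  ∏ g, ∑ l, C (F g l) * X l

/-- The possible exponents of the monomials of a product of `Fintype.card G` linear forms. -/
abbrev ChowIndex (G : Type v) [Fintype G] (ι : Type) : Type := ι → Fin (Fintype.card G + 1)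

/-- The monomial with exponents `α`. -/
def ChowIndex.exponent (α : ChowIndex G ι) : ι →₀ ℕ :=
  Finsupp.equivFunOnFinite.symm fun i => (α i : ℕ)

/-- The coefficients of the product of the linear forms with coefficients `F g`. -/
def chowCoord {R : Type*} [CommRing R] (F : G → ι → R) (α : ChowIndex G ι) : R :=
  coeff α.exponent (chowForm F)

section

variable {R : Type*} [CommRing R]

theorem isHomogeneous_chowForm (F : G → ι → R) :
    (chowForm F).IsHomogeneous (Fintype.card G) := by
  have := IsHomogeneous.prod Finset.univ (fun g => ∑ l, C (F g l) * X l) (fun _ => 1)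
    fun g _ => IsHomogeneous.sum Finset.univ _ 1 fun l _ => isHomogeneous_C_mul_X _ _
  simpa [chowForm] using this

/-- In a form of degree `Fintype.card G` no exponent exceeds that number, so `ChowIndex` misses no
coefficient. -/
theorem exists_exponent_eq (F : G → ι → R) (m : ι →₀ ℕ) (hm : coeff m (chowForm F) ≠ 0) :
    ∃ α : ChowIndex G ι, α.exponent = m := by
  have hdeg := isHomogeneous_chowForm F hm
  refine ⟨fun i => ⟨m i, Nat.lt_succ_of_le ?_⟩, Finsupp.ext fun i => rfl⟩
  rw [← hdeg, Finsupp.weight_apply]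
  simp only [Pi.one_apply, smul_eq_mul, mul_one]
  by_cases hi : m i = 0
  · rw [hi]; exact Nat.zero_le _
  · exact Finset.single_le_sum (f := m) (fun _ _ => Nat.zero_le _) (Finsupp.mem_support_iff.mpr hi)

theorem map_chowForm {S : Type*} [CommRing S] (φ : R →+* S) (F : G → ι → R) :
    map φ (chowForm F) = chowForm fun g l => φ (F g l) := by
  simp [chowForm, map_prod, map_sum]

theorem map_chowCoord {S : Type*} [CommRing S] (φ : R →+* S) (F : G → ι → R)
    (α : ChowIndex G ι) : φ (chowCoord F α) = chowCoord (fun g l => φ (F g l)) α := by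
  rw [chowCoord, chowCoord, ← map_chowForm, coeff_map]

theorem chowCoord_smul (u : G → R) (F : G → ι → R) (α : ChowIndex G ι) :
    chowCoord (fun g l => u g * F g l) α = (∏ g, u g) * chowCoord F α := by
  have : chowForm (fun g l => u g * F g l) = C (∏ g, u g) * chowForm F := by
    simp only [chowForm, map_prod, ← Finset.prod_mul_distrib, Finset.mul_sum, map_mul, mul_assoc]
  rw [chowCoord, this, coeff_C_mul, chowCoord]

theorem chowCoord_reindex (e : G ≃ G) (F : G → ι → R) :
    chowCoord (fun g => F (e g)) = chowCoord F := by
  have : chowForm (fun g => F (e g)) = chowForm F :=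
    Equiv.prod_comp e fun g => ∑ l, C (F g l) * X l
  funext α
  rw [chowCoord, this, chowCoord]

theorem exists_chowCoord_ne_zero [IsDomain R] (F : G → ι → R) (hF : ∀ g, ∃ l, F g l ≠ 0) :
    ∃ α, chowCoord F α ≠ 0 := by
  classical
  have hne : chowForm F ≠ 0 := by
    refine Finset.prod_ne_zero_iff.mpr fun g _ h => ?_
    obtain ⟨l, hl⟩ := hF g
    apply hl
    have := congrArg (coeff (Finsupp.single l 1)) h
    simpa [coeff_sum, coeff_C_mul, coeff_X, Finsupp.single_left_inj, Pi.single_apply] using this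
  obtain ⟨m, hm⟩ := exists_coeff_ne_zero hne
  obtain ⟨α, rfl⟩ := exists_exponent_eq F m hm
  exact ⟨α, hm⟩

end

attribute [local instance] MvPolynomial.gradedAlgebra

theorem hom_ext_of_points {Y Z : Scheme.{u}} {f g : Y ⟶ Z}
    (h : ∀ t : Y, ∃ (R : CommRingCat.{u}) (y : Spec R ⟶ Y),
      IsOpenImmersion y ∧ t ∈ Set.range y ∧ y ≫ f = y ≫ g) : f = g := by
  choose R y hy ht hfg using h
  let 𝒰 : Y.AffineOpenCover :=
    { I₀ := Y, X := R, f := y, idx := id, covers := ht, map_prop := hy }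
  exact Scheme.Cover.hom_ext 𝒰.openCover _ _ hfg

variable {k : Type u} [Field k]

/-- `z` has as coordinates the coefficients of the product over `g` of the linear forms whose
coefficients are the coordinates of `y ≫ a g`. -/
def HasChowCoords {Y : Scheme.{u}} (a : G → (Y ⟶ projectiveSpaceOf k ι)) {R : CommRingCat.{u}}
    (y : Spec R ⟶ Y) (z : Spec R ⟶ projectiveSpaceOf k (ChowIndex G ι)) : Prop :=
  ∃ (s : k →+* R) (F : G → ι → R), (∀ g, HasCoords (y ≫ a g) s (F g)) ∧
    HasCoords z s (chowCoord F)

variable {Y : Scheme.{u}} {a : G → (Y ⟶ projectiveSpaceOf k ι)} {R : CommRingCat.{u}}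
  {y : Spec R ⟶ Y} {z z' : Spec R ⟶ projectiveSpaceOf k (ChowIndex G ι)}

theorem HasChowCoords.comp {S : CommRingCat.{u}} (φ : R ⟶ S) (h : HasChowCoords a y z) :
    HasChowCoords a (Spec.map φ ≫ y) (Spec.map φ ≫ z) := by
  obtain ⟨s, F, hF, hz⟩ := h
  refine ⟨φ.hom.comp s, fun g => φ.hom ∘ F g, fun g => ?_, ?_⟩
  · rw [Category.assoc]
    exact (hF g).comp φ
  · convert hz.comp φ using 1
    funext α
    exact (map_chowCoord φ.hom F α).symm

/-- Changing the coordinates of each `y ≫ a g` by a unit multiplies the Chow form by the product of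
these units, which does not move the projective point. -/
theorem HasChowCoords.unique [Nonempty G] (h : HasChowCoords a y z) (h' : HasChowCoords a y z') :
    z = z' := by
  obtain ⟨s, F, hF, hz⟩ := h
  obtain ⟨s', F', hF', hz'⟩ := h'
  obtain rfl : s = s' := by
    have g : G := Classical.arbitrary G
    have h1 := (hF g).comp_hom.symm.trans (hF' g).comp_hom
    exact congrArg CommRingCat.Hom.hom (Spec.map_injective h1)
  choose u hu using fun g => (hF g).exists_unit (hF' g)
  have hF'' : F' = fun g l => u g * F g l := funext fun g => funext fun l => hu g l
  refine (hz.smul (∏ g, u g)).unique ?_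
  convert hz' using 1
  funext α
  rw [hF'', chowCoord_smul, Units.coe_prod]

theorem HasChowCoords.comp_hom [Nonempty G] (h : HasChowCoords a y z) (g : G) :
    z ≫ projectiveSpaceOfHom k (ChowIndex G ι) = y ≫ a g ≫ projectiveSpaceOfHom k ι := by
  obtain ⟨s, F, hF, hz⟩ := h
  rw [hz.comp_hom, ← Category.assoc, (hF g).comp_hom]

/-- On an affine neighbourhood of `t` every `a g` has coordinates. Over the residue field at `t` a
product of nonzero linear forms is nonzero, so some coefficient is nonzero there; inverting it gives
the neighbourhood sought. -/
theorem exists_hasChowCoords [Nonempty G]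
    (ha : ∀ g g', a g ≫ projectiveSpaceOfHom k ι = a g' ≫ projectiveSpaceOfHom k ι) (t : Y) :
    ∃ (R : CommRingCat.{u}) (y : Spec R ⟶ Y) (z : Spec R ⟶ projectiveSpaceOf k (ChowIndex G ι)),
      IsOpenImmersion y ∧ t ∈ Set.range y ∧ HasChowCoords a y z := by
  choose j hj using fun g => exists_mem_basicOpen_X (a g t)
  let V : Y.Opens :=
    ⟨⋂ g, (a g ⁻¹ᵁ Proj.basicOpen (homogeneousSubmodule ι k) (X (j g)) : Y.Opens).carrier,
      isOpen_iInter_of_finite fun g => (a g ⁻¹ᵁ _ : Y.Opens).2⟩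
  have htV : t ∈ V := Set.mem_iInter.mpr hj
  obtain ⟨W, hW, htW, hWV⟩ := exists_isAffineOpen_mem_and_subset htV
  have hcoords : ∀ g, ∃ (s : k →+* Γ(Y, W)) (c : ι → Γ(Y, W)),
      HasCoords (hW.fromSpec ≫ a g) s c ∧ IsUnit (c (j g)) := by
    intro g
    refine exists_hasCoords _ (j g) ?_
    rintro _ ⟨p, rfl⟩
    have hp : hW.fromSpec p ∈ V := hWV (hW.range_fromSpec.le ⟨p, rfl⟩)
    exact Set.mem_iInter.mp hp g
  choose s c hc hcj using hcoords
  obtain ⟨p, rfl⟩ : t ∈ Set.range hW.fromSpec := by rwa [hW.range_fromSpec]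
  have hs : ∀ g g', s g = s g' := by
    intro g g'
    have h1 : (hW.fromSpec ≫ a g) ≫ projectiveSpaceOfHom k ι =
        (hW.fromSpec ≫ a g') ≫ projectiveSpaceOfHom k ι := by
      rw [Category.assoc, Category.assoc, ha g g']
    rw [(hc g).comp_hom, (hc g').comp_hom] at h1
    exact congrArg CommRingCat.Hom.hom (Spec.map_injective h1)
  let g₀ : G := Classical.arbitrary G
  have hprime : (PrimeSpectrum.asIdeal p).IsPrime := PrimeSpectrum.isPrime p
  obtain ⟨α, hα⟩ := exists_chowCoord_ne_zero
    (fun g l => algebraMap Γ(Y, W) (PrimeSpectrum.asIdeal p).ResidueField (c g l))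
    fun g => ⟨j g, ((hcj g).map _).ne_zero⟩
  rw [← map_chowCoord] at hα
  let r := chowCoord c α
  let φ : Γ(Y, W) ⟶ CommRingCat.of (Localization.Away r) :=
    CommRingCat.ofHom (algebraMap Γ(Y, W) (Localization.Away r))
  have hunit : IsUnit (chowCoord (fun g => φ.hom ∘ c g) α) := by
    have h := map_chowCoord φ.hom c α
    have hr : IsUnit (φ.hom r) := IsLocalization.Away.algebraMap_isUnit r
    exact h ▸ hr
  refine ⟨.of (Localization.Away r), Spec.map φ ≫ hW.fromSpec,
    coordPoint (φ.hom.comp (s g₀)) (chowCoord fun g => φ.hom ∘ c g) (X α) (X_mem α) one_pos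
      (by simpa using hunit), inferInstance, ?_, φ.hom.comp (s g₀), fun g => φ.hom ∘ c g,
      fun g => ?_, α, _, rfl⟩
  · obtain ⟨q, hq⟩ : p ∈ Set.range (Spec.map φ) := by
      have h := PrimeSpectrum.localization_away_comap_range (Localization.Away r) r
      refine h.ge ?_
      intro hr
      apply hα
      rwa [Ideal.algebraMap_residueField_eq_zero]
    exact ⟨q, by rw [Scheme.Hom.comp_apply, hq]⟩
  · rw [hs g₀ g, Category.assoc]
    exact (hc g).comp φ

/-- The morphism to projective space given by the coefficients of the product of the linear forms
attached to the morphisms `a g`. -/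
theorem exists_chowMorphism [Nonempty G]
    (ha : ∀ g g', a g ≫ projectiveSpaceOfHom k ι = a g' ≫ projectiveSpaceOfHom k ι) :
    ∃ c : Y ⟶ projectiveSpaceOf k (ChowIndex G ι),
      (∀ g, c ≫ projectiveSpaceOfHom k (ChowIndex G ι) = a g ≫ projectiveSpaceOfHom k ι) ∧
      (∀ (r : Y ⟶ Y) (e : G ≃ G), (∀ g, r ≫ a g = a (e g)) → r ≫ c = c) ∧
      ∀ {R : CommRingCat.{u}} (y : Spec R ⟶ Y) (z : Spec R ⟶ projectiveSpaceOf k (ChowIndex G ι)),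
        HasChowCoords a y z → y ≫ c = z := by
  obtain ⟨c, hc⟩ := exists_hom_of_points (Y := Y) (Z := projectiveSpaceOf k (ChowIndex G ι))
    (fun R y z => HasChowCoords a y z) (fun φ y z h => h.comp φ) (fun y z z' h h' => h.unique h')
    (exists_hasChowCoords ha)
  refine ⟨c, fun g => hom_ext_of_points fun t => ?_, fun r e hr => hom_ext_of_points fun t => ?_, hc⟩
  · obtain ⟨R, y, z, hy, ht, h⟩ := exists_hasChowCoords ha t
    refine ⟨R, y, hy, ht, ?_⟩
    rw [← h.comp_hom g, ← hc y z h, Category.assoc]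
  · obtain ⟨R, y, z, hy, ht, h⟩ := exists_hasChowCoords ha t
    refine ⟨R, y, hy, ht, ?_⟩
    rw [hc y z h, ← Category.assoc]
    refine hc _ _ ?_
    obtain ⟨s, F, hF, hz⟩ := h
    -- Composition with `r` only permutes the factors of the form.
    refine ⟨s, fun g => F (e g), fun g => ?_, ?_⟩
    · rw [Category.assoc, hr]
      exact hF (e g)
    · rwa [chowCoord_reindex e F]

end ChowForms

/-! ### Galois extensions from Chow forms -/

section ChowGalois

open Polynomial

/-- If a finite family `σ` of automorphisms of `L` over `E` is such that the product of the
conjugates under `σ` of a linear form whose coefficients generate `L` is defined over `E`, then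
`L` is Galois over `E`, and `σ` exhausts the Galois group. -/
theorem isGalois_of_chowForm {E L : Type*} [Field E] [CharZero E] [Field L] [Algebra E L]
    {G : Type v} [Fintype G] {ι : Type} [Fintype ι] (σ : G → Gal(L/E)) {g₀ : G} (hg₀ : σ g₀ = 1)
    (a : ι → L) (j : ι) (haj : a j = 1) (ha : IntermediateField.adjoin E (Set.range a) = ⊤)
    (Q : MvPolynomial ι E)
    (hQ : MvPolynomial.map (algebraMap E L) Q = chowForm fun g l => σ g (a l)) :
    FiniteDimensional E L ∧ IsGalois E L ∧ Function.Surjective σ := by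
  classical
  -- Substituting `X - t j` for the `j`-th variable and `-t l` for the others turns the factor at
  -- `g` into `X - σ g (∑ t l * a l)`, because `a j = 1`.
  let w : (ι → E) → ι → E[X] := fun t l => (if l = j then X else 0) - C (t l)
  let f : (ι → E) → E[X] := fun t => MvPolynomial.aeval (w t) Q
  have hf : ∀ t, (f t).map (algebraMap E L) =
      ∏ g, (X - C (σ g (∑ l, algebraMap E L (t l) * a l))) := by
    intro t
    have h1 : (f t).map (algebraMap E L) = MvPolynomial.aeval
        (fun l => (w t l).map (algebraMap E L)) (MvPolynomial.map (algebraMap E L) Q) := by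
      rw [MvPolynomial.aeval_def, MvPolynomial.eval₂_map]
      change mapRingHom (algebraMap E L) (MvPolynomial.aeval (w t) Q) = _
      rw [MvPolynomial.aeval_def, MvPolynomial.hom_eval₂]
      congr 1
      ext x
      simp
    rw [h1, hQ, chowForm, map_prod]
    refine Finset.prod_congr rfl fun g _ => ?_
    simp only [w, map_sum, map_mul, MvPolynomial.aeval_C, MvPolynomial.aeval_X,
      Polynomial.map_sub, Polynomial.map_C, mul_sub, Finset.sum_sub_distrib, AlgEquiv.commutes]
    congr 1
    · rw [Finset.sum_eq_single j]
      · simp [haj]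
      · intro l _ hl
        simp [hl]
      · simp
    · refine Finset.sum_congr rfl fun l _ => ?_
      rw [mul_comm]
      rfl
  have hne : ∀ t, f t ≠ 0 := by
    intro t h
    have := hf t
    rw [h, Polynomial.map_zero] at this
    exact (monic_prod_X_sub_C _ _).ne_zero this.symm
  have hsplit : ∀ t, ((f t).map (algebraMap E L)).Splits := by
    intro t
    rw [hf]
    exact Splits.prod fun g _ => Splits.X_sub_C _
  have hroot : ∀ t, (f t).aeval (∑ l, algebraMap E L (t l) * a l) = 0 := by
    intro t
    rw [← eval_map_algebraMap, hf, eval_prod]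
    refine Finset.prod_eq_zero (Finset.mem_univ g₀) ?_
    rw [hg₀, eval_sub, eval_X, eval_C, AlgEquiv.one_apply, sub_self]
  let p : E[X] := ∏ l, f (Pi.single l 1)
  have hp0 : p ≠ 0 := Finset.prod_ne_zero_iff.mpr fun l _ => hne _
  have hpa : ∀ l, a l ∈ p.rootSet L := by
    intro l
    rw [mem_rootSet_of_ne hp0, map_prod]
    refine Finset.prod_eq_zero (Finset.mem_univ l) ?_
    have := hroot (Pi.single l 1)
    rwa [Finset.sum_eq_single l (by intro b _ hb; simp [hb]) (by simp), Pi.single_eq_same, map_one,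
      one_mul] at this
  have hps : p.IsSplittingField E L := by
    rw [isSplittingField_iff_intermediateField]
    refine ⟨?_, ?_⟩
    · rw [Polynomial.map_prod]
      exact Splits.prod fun l _ => hsplit _
    · rw [eq_top_iff, ← ha]
      refine IntermediateField.adjoin.mono _ _ _ ?_
      rintro _ ⟨l, rfl⟩
      exact hpa l
  have hfin : FiniteDimensional E L := IsSplittingField.finiteDimensional L p
  have hnor : Normal E L := Normal.of_isSplittingField p
  have hgal : IsGalois E L := { __ := hnor }
  refine ⟨hfin, hgal, fun τ => ?_⟩
  -- `W g` consists of the `t` for which `τ` and `σ g` agree on `∑ t l * a l`. These subspaces cover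
  -- the whole space, and over an infinite field one of them must be everything.
  let W : G → Submodule E (ι → E) := fun g =>
    LinearMap.ker (Fintype.linearCombination E fun l => τ (a l) - σ g (a l))
  have hW : ∀ t, ∃ g, t ∈ W g := by
    intro t
    have h1 : (f t).aeval (τ (∑ l, algebraMap E L (t l) * a l)) = 0 := by
      rw [aeval_algHom_apply, hroot, map_zero]
    rw [← eval_map_algebraMap, hf, eval_prod, Finset.prod_eq_zero_iff] at h1
    obtain ⟨g, -, hg⟩ := h1
    refine ⟨g, ?_⟩
    rw [LinearMap.mem_ker, Fintype.linearCombination_apply]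
    rw [eval_sub, eval_X, eval_C, map_sum, map_sum, ← Finset.sum_sub_distrib] at hg
    rw [← hg]
    refine Finset.sum_congr rfl fun l _ => ?_
    rw [map_mul, map_mul, AlgEquiv.commutes, AlgEquiv.commutes, ← mul_sub, Algebra.smul_def]
  obtain ⟨g, hg⟩ : ∃ g, W g = ⊤ :=
    Subspace.exists_eq_top_of_iUnion_eq_univ
      (Set.eq_univ_of_forall fun t => Set.mem_iUnion.mpr (hW t))
  refine ⟨g, ?_⟩
  have hal : ∀ l, σ g (a l) = τ (a l) := by
    intro l
    have : Pi.single l 1 ∈ W g := hg ▸ Submodule.mem_top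
    rw [LinearMap.mem_ker, Fintype.linearCombination_apply_single, one_smul, sub_eq_zero] at this
    exact this.symm
  refine AlgEquiv.ext fun x => ?_
  have hx : x ∈ IntermediateField.adjoin E (Set.range a) := ha ▸ IntermediateField.mem_top
  induction hx using IntermediateField.adjoin_induction with
  | mem x hx => obtain ⟨l, rfl⟩ := hx; exact hal l
  | algebraMap x => rw [AlgEquiv.commutes, AlgEquiv.commutes]
  | add x y _ _ hx hy => rw [map_add, map_add, hx, hy]
  | inv x _ hx => rw [map_inv₀, map_inv₀, hx]
  | mul x y _ _ hx hy => rw [map_mul, map_mul, hx, hy]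

end ChowGalois

/-! ### Generic points and the reduced subscheme -/

section GenericPoint

theorem isReduced_subscheme_nilradical (Y : Scheme.{u}) : IsReduced Y.nilradical.subscheme := by
  have : ∀ i, IsReduced (Y.nilradical.subschemeCover.openCover.X i) := by
    intro U
    have : _root_.IsReduced (Γ(Y, U.1) ⧸ Y.nilradical.ideal U) :=
      (Ideal.isRadical_iff_quotient_reduced _).mp (Ideal.radical_isRadical _)
    exact inferInstanceAs (IsReduced (Spec (.of (Γ(Y, U.1) ⧸ Y.nilradical.ideal U))))
  exact IsReduced.of_openCover _ Y.nilradical.subschemeCover.openCover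

theorem surjective_subschemeι_nilradical (Y : Scheme.{u}) : Surjective Y.nilradical.subschemeι := by
  refine ⟨Set.range_eq_univ.mp ?_⟩
  rw [Scheme.IdealSheafData.range_subschemeι, Scheme.support_nilradical]
  rfl

theorem map_genericPoint {T Y : Scheme.{u}} [IrreducibleSpace T] [IrreducibleSpace Y] (f : T ⟶ Y)
    [IsDominant f] : f (genericPoint T) = genericPoint Y := by
  refine IsGenericPoint.eq ?_ (genericPoint_spec Y)
  have h := (genericPoint_spec T).image f.continuous
  rwa [Set.image_univ, f.denseRange.closure_range] at h

instance isDominant_fromSpecResidueField (Y : Scheme.{u}) [IrreducibleSpace Y] :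
    IsDominant (Y.fromSpecResidueField (genericPoint Y)) := by
  refine ⟨?_⟩
  rw [denseRange_iff_closure_range, Scheme.range_fromSpecResidueField]
  exact genericPoint_closure Y

theorem exists_fromSpecResidueField_comp {T Y : Scheme.{u}} [IrreducibleSpace T]
    [IrreducibleSpace Y] (f : T ⟶ Y) [IsDominant f] :
    ∃ χ : Y.residueField (genericPoint Y) ⟶ T.residueField (genericPoint T),
      T.fromSpecResidueField (genericPoint T) ≫ f =
        Spec.map χ ≫ Y.fromSpecResidueField (genericPoint Y) := by
  refine ⟨(Y.residueFieldCongr (map_genericPoint f).symm).hom ≫ f.residueFieldMap _, ?_⟩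
  rw [Spec.map_comp, Category.assoc, Scheme.residueFieldCongr_fromSpecResidueField,
    Scheme.Hom.SpecMap_residueFieldMap_fromSpecResidueField]

/-- An endomorphism of an irreducible separated scheme over `S` which is trivial on the generic
point is trivial on the underlying reduced scheme. -/
theorem subschemeι_nilradical_comp_eq {Y S : Scheme.{u}} [IrreducibleSpace Y] (p : Y ⟶ S)
    [IsSeparated p] (f : Y ⟶ Y) (hf : f ≫ p = p)
    (h : Y.fromSpecResidueField (genericPoint Y) ≫ f =
      Y.fromSpecResidueField (genericPoint Y)) :
    Y.nilradical.subschemeι ≫ f = Y.nilradical.subschemeι := by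
  have := isReduced_subscheme_nilradical Y
  have := surjective_subschemeι_nilradical Y
  have hne : IrreducibleSpace Y.nilradical.subscheme := by
    let e : Y.nilradical.subscheme ≃ₜ Y :=
      Y.nilradical.subschemeι.isEmbedding.toHomeomorphOfSurjective Y.nilradical.subschemeι.surjective
    have h := (IrreducibleSpace.isIrreducible_univ Y).image e.symm e.symm.continuous.continuousOn
    rw [Set.image_univ, e.symm.surjective.range_eq] at h
    exact { isPreirreducible_univ := h.2, toNonempty := ⟨h.1.some⟩ }
  obtain ⟨χ, hχ⟩ := exists_fromSpecResidueField_comp Y.nilradical.subschemeι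
  refine ext_of_isDominant_of_isSeparated p (by rw [Category.assoc, hf])
    (Y.nilradical.subscheme.fromSpecResidueField (genericPoint _)) ?_
  rw [reassoc_of% hχ, h, hχ]

end GenericPoint

/-! ### Dominance of the quotient map -/

section Quotient

variable {k : Type u} [Field k] {G : Type v} [Group G] {Y X : SchOver k} {ρ : G →* Aut Y}
  {π : Y ⟶ X}

/-- The morphism to the quotient variety is dominant. -/
theorem IsQuotientVariety.isDominant (hY : IsVariety Y) (h : IsQuotientVariety ρ π) :
    IsDominant π.left := by
  have := h.isVariety.isSeparated
  have := h.isVariety.locallyOfFiniteType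
  have := h.isVariety.quasiCompact
  have := hY.quasiCompact
  have : QuasiCompact π.left := by
    have : QuasiCompact (π.left ≫ X.hom) := by rw [Over.w]; infer_instance
    exact QuasiCompact.of_comp _ X.hom
  -- The scheme-theoretic image is itself a variety with an invariant map from `Y`, so it receives a
  -- map from `X`; by uniqueness `X ⟶ Z ⟶ X` is the identity, and `Z` fills `X`.
  let Z : SchOver k := Over.mk (π.left.imageι ≫ X.hom)
  let t : Y ⟶ Z := Over.homMk π.left.toImage (by simp [Z])
  let j : Z ⟶ X := Over.homMk π.left.imageι rfl
  have htj : t ≫ j = π := by ext1; simp [t, j]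
  have hmono : Mono j.left := inferInstanceAs (Mono π.left.imageι)
  have hZ : IsVariety Z := ⟨inferInstanceAs (IsSeparated (π.left.imageι ≫ X.hom)),
    inferInstanceAs (LocallyOfFiniteType (π.left.imageι ≫ X.hom)),
    inferInstanceAs (QuasiCompact (π.left.imageι ≫ X.hom))⟩
  obtain ⟨s, hs, -⟩ := h.existsUnique_desc Z hZ t fun g => by
    ext1
    rw [← cancel_mono j.left, ← Over.comp_left, ← Over.comp_left, Category.assoc, htj,
      h.invariant]
  obtain ⟨_, -, huniq⟩ := h.existsUnique_desc X h.isVariety π h.invariant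
  have hsj : s ≫ j = 𝟙 X := by
    beta_reduce at huniq
    rw [huniq (s ≫ j) (by rw [← Category.assoc, hs, htj]), huniq (𝟙 X) (Category.comp_id π)]
  have hsurj : Surjective π.left.imageι := ⟨fun x => ⟨s.left x, by
    change j.left (s.left x) = x
    rw [← Scheme.Hom.comp_apply, ← Over.comp_left, hsj]
    rfl⟩⟩
  rw [← π.left.toImage_imageι]
  infer_instance

end Quotient

/-! ### The generic point of a rational variety -/

section Rational

theorem injective_of_isDominant_specMap {R S : CommRingCat.{u}} [IsDomain R] (φ : R ⟶ S)
    [IsDominant (Spec.map φ)] : Function.Injective φ.hom := by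
  rw [injective_iff_map_eq_zero]
  intro r hr
  have h := (PrimeSpectrum.denseRange_comap_iff_ker_le_nilRadical φ.hom).mp (Spec.map φ).denseRange
  simpa [nilradical_eq_zero] using h (RingHom.mem_ker.mpr hr)

/-- A dense point of `X` with values in `L` factors through the generic point of any open subscheme
of an affine integral scheme which is isomorphic to a dense open subscheme of `X`. -/
theorem exists_fractionRing_point {X : Scheme.{u}} {A : CommRingCat.{u}} [IsDomain A]
    (e : X.PartialIso (Spec A)) {L : Type u} [Field L] (x : Spec (.of L) ⟶ X) [IsDominant x] :
    ∃ (ψ : FractionRing A →+* L) (w : Spec (.of (FractionRing A)) ⟶ X),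
      Mono w ∧ Spec.map (CommRingCat.ofHom ψ) ≫ w = x := by
  have hsub : ∀ p q : Spec (CommRingCat.of L), p = q := fun p q =>
    Subsingleton.elim (α := PrimeSpectrum L) p q
  have hXne : Nonempty X := ⟨x (default : PrimeSpectrum L)⟩
  -- `Spec L` has one point and its image is dense, so it lies in every nonempty open subset.
  have hrange : Set.range x ⊆ Set.range e.source.ι := by
    obtain ⟨_, hU, p, rfl⟩ := x.denseRange.inter_open_nonempty e.source e.source.2
      e.dense_source.nonempty
    rintro _ ⟨q, rfl⟩
    rw [hsub q p, Scheme.Opens.range_ι]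
    exact hU
  let x₁ : Spec (.of L) ⟶ e.source := IsOpenImmersion.lift e.source.ι x hrange
  have hx₁ : x₁ ≫ e.source.ι = x := IsOpenImmersion.lift_fac _ _ _
  have : IsDominant x₁ := by
    have : IsDominant (x₁ ≫ e.source.ι) := by rw [hx₁]; infer_instance
    exact IsDominant.of_comp_of_isOpenImmersion x₁ e.source.ι
  have := AlgebraicGeometry.Opens.isDominant_ι e.dense_target
  obtain ⟨φ, hφ⟩ : ∃ φ : A ⟶ .of L, Spec.map φ = x₁ ≫ e.iso.hom ≫ e.target.ι :=
    ⟨Spec.preimage _, Spec.map_preimage _⟩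
  have : IsDominant (Spec.map φ) := by rw [hφ]; infer_instance
  have hinj := injective_of_isDominant_specMap φ
  let ψ : FractionRing A →+* L := IsFractionRing.lift hinj
  let ε : A ⟶ .of (FractionRing A) := CommRingCat.ofHom (algebraMap A (FractionRing A))
  have hψ : ε ≫ CommRingCat.ofHom ψ = φ := by
    ext a
    exact IsFractionRing.lift_algebraMap hinj a
  -- Localizations are epimorphisms of rings, so the generic point is a monomorphism.
  have hepi : Epi ε := IsLocalization.epi (nonZeroDivisors A) (FractionRing A)
  have hmono : Mono (Spec.map ε) := inferInstanceAs (Mono (Scheme.Spec.map ε.op))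
  have hrange' : Set.range (Spec.map ε) ⊆ Set.range e.target.ι := by
    rintro _ ⟨q, rfl⟩
    have ⟨p⟩ : Nonempty (Spec (CommRingCat.of L)) := ⟨(default : PrimeSpectrum L)⟩
    have hq : q = Spec.map (CommRingCat.ofHom ψ) p :=
      Subsingleton.elim (α := PrimeSpectrum (FractionRing A)) _ _
    rw [hq, ← Scheme.Hom.comp_apply, ← Spec.map_comp, hψ, hφ, ← Category.assoc,
      Scheme.Hom.comp_apply]
    exact ⟨_, rfl⟩
  let w₁ : Spec (.of (FractionRing A)) ⟶ e.target :=
    IsOpenImmersion.lift e.target.ι (Spec.map ε) hrange'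
  have hw₁ : w₁ ≫ e.target.ι = Spec.map ε := IsOpenImmersion.lift_fac _ _ _
  have : Mono w₁ := by
    have : Mono (w₁ ≫ e.target.ι) := by rw [hw₁]; infer_instance
    exact mono_of_mono w₁ e.target.ι
  refine ⟨ψ, w₁ ≫ e.iso.inv ≫ e.source.ι, inferInstance, ?_⟩
  have h : Spec.map (CommRingCat.ofHom ψ) ≫ w₁ = x₁ ≫ e.iso.hom := by
    rw [← cancel_mono e.target.ι, Category.assoc, Category.assoc, hw₁, ← Spec.map_comp, hψ, hφ]
  rw [reassoc_of% h, Iso.hom_inv_id_assoc, hx₁]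

theorem IsRational.exists_fractionRing_point {k : Type u} [Field k] {X : SchOver k}
    (hX : IsRational X) {L : Type u} [Field L] (x : Spec (.of L) ⟶ X.left) [IsDominant x] :
    ∃ (n : ℕ) (ψ : FractionRing (MvPolynomial (Fin n) k) →+* L)
      (w : Spec (.of (FractionRing (MvPolynomial (Fin n) k))) ⟶ X.left),
      Mono w ∧ Spec.map (CommRingCat.ofHom ψ) ≫ w = x := by
  obtain ⟨n, f, -⟩ := hX
  let r : CommRingCat.of (MvPolynomial (ULift.{u} (Fin n)) k) ≅
      CommRingCat.of (MvPolynomial (Fin n) k) :=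
    (MvPolynomial.renameEquiv k Equiv.ulift).toRingEquiv.toCommRingCatIso
  let i : 𝔸(ULift.{u} (Fin n); Spec (CommRingCat.of k)) ≅
      Spec (CommRingCat.of (MvPolynomial (Fin n) k)) :=
    AffineSpace.SpecIso _ (CommRingCat.of k) ≪≫ (Scheme.Spec.mapIso r.op).symm
  exact ⟨n, InverseGalois.exists_fractionRing_point
    (f.trans (Scheme.PartialIso.ofIso i)) x⟩

end Rational

/-! ### Fields of definition of points and Chow forms -/

noncomputable section Generation

open MvPolynomial

attribute [local instance] MvPolynomial.gradedAlgebra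

/-- The coordinates of an `L`-valued point of projective space generate `L` if the point is
surjective on stalks. -/
theorem surjective_of_hasCoords {k : Type u} [Field k] {ι : Type} {E L : Type u} [Field E]
    [Field L] (ψ : E →+* L) {s : k →+* E} {c : ι → E} {y : Spec (.of L) ⟶ projectiveSpaceOf k ι}
    [SurjectiveOnStalks y] {j : ι} (hj : c j ≠ 0)
    (hy : HasCoords (R := .of L) y (ψ.comp s) (ψ ∘ c)) : Function.Surjective ψ := by
  obtain ⟨z, hz⟩ : ∃ z : Spec (.of E) ⟶ projectiveSpaceOf k ι, HasCoords z s c :=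
    ⟨coordPoint s c (X j) (X_mem j) one_pos (by simpa using hj), j, _, rfl⟩
  -- Having coordinates in `E`, the point `y` factors through `Spec E`; a homomorphism of fields
  -- that is surjective on stalks is surjective.
  have h := hy.unique (hz.comp (CommRingCat.ofHom ψ))
  have : SurjectiveOnStalks (Spec.map (CommRingCat.ofHom ψ) ≫ z) := h ▸ inferInstance
  have hs := SurjectiveOnStalks.of_comp (Spec.map (CommRingCat.ofHom ψ)) z
  exact RingHom.surjectiveOnStalks_iff_of_isLocalHom.mp (SurjectiveOnStalks.Spec_iff.mp hs)

theorem HasCoords.exists_eq_one {k : Type u} [Field k] {ι : Type} {R : CommRingCat.{u}}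
    {y : Spec R ⟶ projectiveSpaceOf k ι} {s : k →+* R} {c : ι → R} (h : HasCoords y s c) :
    ∃ (j : ι) (c' : ι → R), c' j = 1 ∧ HasCoords y s c' := by
  obtain ⟨j, hj, hy⟩ := id h
  have hj' : IsUnit (c j) := by simpa using hj
  exact ⟨j, _, hj'.val_inv_mul, h.smul hj'.unit⁻¹⟩

theorem exists_hasCoords_field {k : Type u} [Field k] {ι : Type} {E : Type u} [Field E]
    (y : Spec (.of E) ⟶ projectiveSpaceOf k ι) :
    ∃ (s : k →+* E) (c : ι → E), HasCoords (R := .of E) y s c := by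
  obtain ⟨j, hj⟩ := exists_mem_basicOpen_X (y (default : PrimeSpectrum E))
  obtain ⟨s, c, h, -⟩ := exists_hasCoords y j (by
    rintro _ ⟨q, rfl⟩
    rwa [Subsingleton.elim (α := PrimeSpectrum E) q default])
  exact ⟨s, c, h⟩

/-- The coefficients lie in `E` only up to the scalar `u`. Since every `F g j` is `1`, so is the
value of the Chow form at the `j`-th basis vector; hence `u` comes from `E` and can be divided out.
-/
theorem exists_map_eq_chowForm {E L : Type*} [Field E] [Field L] (ψ : E →+* L)
    {G : Type v} [Fintype G] {ι : Type} [Fintype ι] (F : G → ι → L) {j : ι}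
    (hj : ∀ g, F g j = 1) (b : ChowIndex G ι → E) (u : Lˣ)
    (hb : ∀ α, ψ (b α) = u * chowCoord F α) :
    ∃ Q : MvPolynomial ι E, map ψ Q = chowForm F := by
  classical
  have h1 : ∃ Q : MvPolynomial ι E, map ψ Q = C (u : L) * chowForm F := by
    refine mem_range_map_iff_coeffs_subset.mpr fun x hx => ?_
    obtain ⟨m, hm, rfl⟩ := mem_coeffs_iff.mp hx
    rw [coeff_C_mul]
    have hm' : coeff m (chowForm F) ≠ 0 := by
      intro h
      rw [mem_support_iff, coeff_C_mul, h, mul_zero] at hm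
      exact hm rfl
    obtain ⟨α, rfl⟩ := exists_exponent_eq F m hm'
    exact ⟨b α, hb α⟩
  obtain ⟨Q, hQ⟩ := h1
  have h2 : ψ (eval (Pi.single j 1) Q) = u := by
    have h3 : eval (Pi.single j 1) (chowForm F) = 1 := by
      simp [chowForm, map_prod, Pi.single_apply, hj]
    have h4 := congrArg (eval (Pi.single j (1 : L))) hQ
    rw [map_mul, eval_C, h3, mul_one] at h4
    have h5 : ψ ∘ (Pi.single j (1 : E)) = Pi.single j (1 : L) := by
      funext l
      by_cases hl : l = j
      · subst hl; simp
      · simp [hl]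
    rw [← h4, MvPolynomial.eval_map, MvPolynomial.eval, coe_eval₂Hom, hom_eval₂, RingHom.comp_id]
    exact congrArg (fun v => eval₂ ψ v Q) h5
  refine ⟨C (eval (Pi.single j 1) Q)⁻¹ * Q, ?_⟩
  rw [map_mul, map_C, map_inv₀, h2, hQ, ← mul_assoc, ← C_mul, inv_mul_cancel₀ u.ne_zero, C_1,
    one_mul]

end Generation

/-! ### The Galois extension attached to the quotient -/

section FunctionField

open MvPolynomial Module

attribute [local instance] MvPolynomial.gradedAlgebra

variable {k : Type u} [Field k] {G : Type v} [Group G]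

/-- The action on the generic point of an irreducible variety. -/
theorem exists_generic_action {Y : SchOver k} (hY : IsVariety Y) [IrreducibleSpace Y.left]
    (ρ : G →* Aut Y) (hρ : IsFaithfulOnReduced ρ) :
    ∃ (L : Type u) (_ : Field L) (x : Spec (.of L) ⟶ Y.left) (σ : G → L →+* L),
      IsPreimmersion x ∧ IsDominant x ∧
      (∀ g, x ≫ (ρ g).hom.left = Spec.map (CommRingCat.ofHom (σ g)) ≫ x) ∧
      (∀ g h, σ (g * h) = (σ h).comp (σ g)) ∧ (∀ g, σ g = RingHom.id L ↔ g = 1) := by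
  have := hY.isSeparated
  let L := Y.left.residueField (genericPoint Y.left)
  let x : Spec (.of L) ⟶ Y.left := Y.left.fromSpecResidueField (genericPoint Y.left)
  have hpre : IsPreimmersion x :=
    inferInstanceAs (IsPreimmersion (Y.left.fromSpecResidueField (genericPoint Y.left)))
  have hσ : ∀ g, ∃ σ : L →+* L, x ≫ (ρ g).hom.left = Spec.map (CommRingCat.ofHom σ) ≫ x := by
    intro g
    let e : Y ≅ Y := ρ g
    have : IsIso e.hom.left := inferInstanceAs (IsIso ((Over.forget _).map e.hom))
    obtain ⟨χ, hχ⟩ := exists_fromSpecResidueField_comp e.hom.left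
    exact ⟨χ.hom, hχ⟩
  choose σ hσ using hσ
  have huniq : ∀ τ τ' : L →+* L, Spec.map (CommRingCat.ofHom τ) ≫ x =
      Spec.map (CommRingCat.ofHom τ') ≫ x → τ = τ' := by
    intro τ τ' h
    rw [cancel_mono] at h
    exact congrArg CommRingCat.Hom.hom (Spec.map_injective h)
  refine ⟨L, inferInstanceAs (Field L), x, σ, hpre,
    isDominant_fromSpecResidueField Y.left, hσ, fun g h => ?_, fun g => ⟨fun hg => ?_, ?_⟩⟩
  · refine huniq _ _ ?_
    rw [← hσ, map_mul, CommRingCat.ofHom_comp, Spec.map_comp, Category.assoc, ← hσ,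
      ← Category.assoc, ← hσ, Category.assoc]
    rfl
  · refine hρ g (subschemeι_nilradical_comp_eq Y.hom _ (Over.w _) ?_)
    refine (hσ g).trans ?_
    rw [hg]
    simp [x]
  · rintro rfl
    refine huniq _ _ ?_
    rw [← hσ, map_one]
    refine (Category.comp_id x).trans ?_
    simp

/-- An action of `G` on a field `L` over the field `E` through which a point of a quasi-projective
scheme descends comes from a Galois extension `L / E`. -/
theorem exists_galois_of_point [Fintype G] {ι : Type} [Fintype ι] {Y X : Scheme.{u}}
    (r : G → (Y ⟶ Y)) (hrmul : ∀ g h, r (g * h) = r h ≫ r g)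
    (i : Y ⟶ projectiveSpaceOf k ι) [SurjectiveOnStalks i]
    (hri : ∀ g, r g ≫ i ≫ projectiveSpaceOfHom k ι = i ≫ projectiveSpaceOfHom k ι)
    (π : Y ⟶ X) (hrπ : ∀ g, r g ≫ π = π)
    (hdesc : ∀ c : Y ⟶ projectiveSpaceOf k (ChowIndex G ι),
      c ≫ projectiveSpaceOfHom k (ChowIndex G ι) = i ≫ projectiveSpaceOfHom k ι →
      (∀ g, r g ≫ c = c) → ∃ h : X ⟶ projectiveSpaceOf k (ChowIndex G ι), π ≫ h = c)
    {E L : Type u} [Field E] [CharZero E] [Field L] [Algebra E L] (x : Spec (.of L) ⟶ Y)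
    [SurjectiveOnStalks x] (w : Spec (.of E) ⟶ X) [Mono w]
    (hw : Spec.map (CommRingCat.ofHom (algebraMap E L)) ≫ w = x ≫ π)
    (σ : G → L →+* L) (hxσ : ∀ g, x ≫ r g = Spec.map (CommRingCat.ofHom (σ g)) ≫ x)
    (hmul : ∀ g h, σ (g * h) = (σ h).comp (σ g)) (hone : ∀ g, σ g = RingHom.id L ↔ g = 1) :
    FiniteDimensional E L ∧ IsGalois E L ∧ Nonempty (Gal(L/E) ≃* G) := by
  obtain ⟨c, hchom, hcinv, hcpt⟩ := exists_chowMorphism (a := fun g => r g ≫ i) fun g g' => by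
    rw [Category.assoc, Category.assoc, hri, hri]
  -- `r g ≫ r g' = r (g' * g)`, so `r g` permutes the factors by right multiplication.
  obtain ⟨h, hhc⟩ := hdesc c (by rw [hchom 1, Category.assoc, hri]) fun g =>
    hcinv _ (Equiv.mulRight g) fun g' => by
      rw [Equiv.coe_mulRight, hrmul, Category.assoc]
  obtain ⟨s, b₀, hb₀⟩ := exists_hasCoords_field (x ≫ i)
  obtain ⟨j, b, hbj, hb⟩ := hb₀.exists_eq_one
  have hs : x ≫ i ≫ projectiveSpaceOfHom k ι = Spec.map (CommRingCat.ofHom s) := by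
    rw [← Category.assoc, hb.comp_hom]
  have hσs : ∀ g, (σ g).comp s = s := by
    intro g
    have h1 : Spec.map (CommRingCat.ofHom (σ g)) ≫ x ≫ i ≫ projectiveSpaceOfHom k ι =
        x ≫ i ≫ projectiveSpaceOfHom k ι := by
      rw [← reassoc_of% (hxσ g), hri]
    rw [hs, ← Spec.map_comp] at h1
    exact congrArg CommRingCat.Hom.hom (Spec.map_injective h1)
  let F : G → ι → L := fun g l => σ g (b l)
  have hF : ∀ g, HasCoords (R := .of L) (x ≫ r g ≫ i) s (F g) := by
    intro g
    have h1 := hb.comp (CommRingCat.ofHom (σ g))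
    rw [← Category.assoc, ← hxσ, Category.assoc] at h1
    exact hσs g ▸ h1
  have hFj : ∀ g, F g j = 1 := fun g => (congrArg (σ g) hbj).trans (map_one _)
  obtain ⟨α, hα⟩ := exists_chowCoord_ne_zero F fun g => ⟨j, by simp [hFj]⟩
  have hxc : HasCoords (R := .of L) (x ≫ c) s (chowCoord F) := by
    have h1 : HasCoords (R := .of L) (coordPoint s (chowCoord F) (MvPolynomial.X α) (X_mem α)
      one_pos (by simpa using hα)) s (chowCoord F) := ⟨α, _, rfl⟩
    rw [hcpt x _ ⟨s, F, hF, h1⟩]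
    exact h1
  -- The point `w ≫ h` is defined over `E` and becomes `x ≫ c` over `L`, so the Chow coordinates are
  -- proportional to elements of `E`.
  obtain ⟨s', d, hd⟩ := exists_hasCoords_field (w ≫ h)
  have hd' := hd.comp (CommRingCat.ofHom (algebraMap E L))
  rw [← Category.assoc, hw, Category.assoc, hhc] at hd'
  have hss' : (algebraMap E L).comp s' = s := by
    have h1 := hd'.comp_hom.symm.trans hxc.comp_hom
    exact congrArg CommRingCat.Hom.hom (Spec.map_injective h1)
  obtain ⟨u, hu⟩ := hxc.exists_unit (c' := algebraMap E L ∘ d) (by rw [← hss']; exact hd')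
  obtain ⟨Q, hQ⟩ := exists_map_eq_chowForm (algebraMap E L) F hFj d u hu
  have hσψ : ∀ g, (σ g).comp (algebraMap E L) = algebraMap E L := by
    intro g
    have h1 : Spec.map (CommRingCat.ofHom (σ g)) ≫
        Spec.map (CommRingCat.ofHom (algebraMap E L)) ≫ w =
        Spec.map (CommRingCat.ofHom (algebraMap E L)) ≫ w := by
      rw [hw, ← reassoc_of% (hxσ g), hrπ]
    rw [← Category.assoc, cancel_mono, ← Spec.map_comp] at h1
    exact congrArg CommRingCat.Hom.hom (Spec.map_injective h1)
  have hσ1 : σ 1 = RingHom.id L := (hone 1).mpr rfl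
  -- Pullback of functions reverses products, hence the inverse.
  let σ' : G →* Gal(L/E) :=
    { toFun := fun g => AlgEquiv.ofRingEquiv
        (f := RingEquiv.ofRingHom (σ g⁻¹) (σ g) (by rw [← hmul, mul_inv_cancel, hσ1])
          (by rw [← hmul, inv_mul_cancel, hσ1])) fun e => DFunLike.congr_fun (hσψ g⁻¹) e
      map_one' := AlgEquiv.ext fun y => by
        change σ 1⁻¹ y = y
        rw [inv_one, hσ1]
        rfl
      map_mul' := fun g g' => AlgEquiv.ext fun y => by
        change σ (g * g')⁻¹ y = σ g⁻¹ (σ g'⁻¹ y)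
        rw [mul_inv_rev, hmul]
        rfl }
  have hσ' : ∀ g y, σ' g y = σ g⁻¹ y := fun _ _ => rfl
  -- The point `x ≫ i` is surjective on stalks and has its coordinates in the field they generate
  -- over `E`, which is therefore all of `L`.
  have hgen : IntermediateField.adjoin E (Set.range b) = ⊤ := by
    let M := IntermediateField.adjoin E (Set.range b)
    have hbM : ∀ l, b l ∈ M := fun l => IntermediateField.subset_adjoin _ _ ⟨l, rfl⟩
    have hsurj : Function.Surjective (algebraMap M L) :=
      surjective_of_hasCoords (y := x ≫ i) (algebraMap M L) (s := (algebraMap E M).comp s')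
        (c := fun l => ⟨b l, hbM l⟩) (j := j)
        (fun h0 => one_ne_zero (hbj.symm.trans (congrArg Subtype.val h0))) (by
          rw [← RingHom.comp_assoc, ← IsScalarTower.algebraMap_eq, hss']
          exact hb)
    rw [eq_top_iff]
    intro y _
    obtain ⟨z, rfl⟩ := hsurj y
    exact z.2
  obtain ⟨hfin, hgal, hsurj⟩ := isGalois_of_chowForm (fun g => σ' g⁻¹) (g₀ := 1)
    (by rw [inv_one, map_one]) b j hbj hgen Q (by simpa only [hσ', inv_inv] using hQ)
  have hinj : Function.Injective σ' := by
    refine (injective_iff_map_eq_one σ').mpr fun g hg => inv_eq_one.mp ((hone _).mp ?_)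
    ext y
    exact (hσ' g y).symm.trans (DFunLike.congr_fun hg y)
  have hsurj' : Function.Surjective σ' := fun τ => by
    obtain ⟨g, hg⟩ := hsurj τ
    exact ⟨g⁻¹, hg⟩
  exact ⟨hfin, hgal, ⟨(MulEquiv.ofBijective σ' ⟨hinj, hsurj'⟩).symm⟩⟩

/-- If `Y/G` is rational, then `G` is a Galois group over a field of rational functions. -/
theorem exists_galois_of_isRational [CharZero k] [Fintype G] {Y X : SchOver k} (hY : IsVariety Y)
    [IrreducibleSpace Y.left]
    (hYqp : IsQuasiProjective Y) (ρ : G →* Aut Y) (hρ : IsFaithfulOnReduced ρ)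
    (π : Y ⟶ X) (hπ : IsQuotientVariety ρ π) (hX : IsRational X) :
    ∃ (n : ℕ) (L : Type u) (_ : Field L) (_ : Algebra (FractionRing (MvPolynomial (Fin n) k)) L),
      FiniteDimensional (FractionRing (MvPolynomial (Fin n) k)) L ∧
      IsGalois (FractionRing (MvPolynomial (Fin n) k)) L ∧
      Nonempty (Gal(L/FractionRing (MvPolynomial (Fin n) k)) ≃* G) := by
  obtain ⟨L, _, x, σ, hxpre, hxdom, hxσ, hmul, hone⟩ := exists_generic_action hY ρ hρ
  have := hπ.isDominant hY
  obtain ⟨n, ψ, w, hw, hψw⟩ := hX.exists_fractionRing_point (x ≫ π.left)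
  obtain ⟨N, i, hi⟩ := hYqp
  have hchar : CharZero (FractionRing (MvPolynomial (Fin n) k)) :=
    charZero_of_injective_algebraMap
      (IsFractionRing.injective (MvPolynomial (Fin n) k) (FractionRing (MvPolynomial (Fin n) k)))
  let i' : Y.left ⟶ projectiveSpaceOf k (Fin (N + 1)) := i.left
  have hi' : SurjectiveOnStalks i' := hi.toSurjectiveOnStalks
  have hicomp : i' ≫ projectiveSpaceOfHom k (Fin (N + 1)) = Y.hom := Over.w i
  let r : G → (Y.left ⟶ Y.left) := fun g => (ρ g).hom.left
  have hrcomp : ∀ g, r g ≫ Y.hom = Y.hom := fun g => Over.w _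
  let : Algebra (FractionRing (MvPolynomial (Fin n) k)) L := ψ.toAlgebra
  refine ⟨n, L, inferInstance, inferInstance, exists_galois_of_point r (fun g h => ?_) i'
    (fun g => ?_) π.left (fun g => ?_) (fun c hc hrc => ?_) x w hψw σ hxσ hmul hone⟩
  · exact congrArg (fun e : Aut Y => e.hom.left) (map_mul ρ g h)
  · rw [hicomp, hrcomp]
  · exact congrArg CommaMorphism.left (hπ.invariant g)
  · let c' : Y ⟶ Over.mk (projectiveSpaceOfHom k (ChowIndex G (Fin (N + 1)))) :=
      Over.homMk c (hc.trans hicomp)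
    obtain ⟨h, hh, -⟩ := hπ.existsUnique_desc _ (isVariety_projectiveSpaceOf k _) c' fun g =>
      Over.OverMorphism.ext (hrc g)
    exact ⟨h.left, congrArg CommaMorphism.left hh⟩

end FunctionField
end InverseGalois

theorem mainTheorem3 (k : Type u) [Field k] [NumberField k] (G : Type v) [Group G] [Finite G]
    (Y : InverseGalois.SchOver k) (hY : InverseGalois.IsVariety Y) [IrreducibleSpace Y.left]
    (hYqp : InverseGalois.IsQuasiProjective Y)
    (ρ : G →* Aut Y) (hρ : InverseGalois.IsFaithfulOnReduced ρ)
    (X : InverseGalois.SchOver k) (π : Y ⟶ X) (hπ : InverseGalois.IsQuotientVariety ρ π)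
    (hX : InverseGalois.IsRational X) :
    ∃ (K : Type u) (_ : Field K) (_ : Algebra k K),
      FiniteDimensional k K ∧ IsGalois k K ∧ Nonempty (Gal(K/k) ≃* G) := by
  cases nonempty_fintype G
  obtain ⟨n, L, _, _, _, _, ⟨e⟩⟩ :=
    InverseGalois.exists_galois_of_isRational hY hYqp ρ hρ π hπ hX
  obtain ⟨K, _, _, hfin, hgal, ⟨e'⟩⟩ := InverseGalois.exists_galois_of_galois_fractionRing k n L
  exact ⟨K, inferInstance, inferInstance, hfin, hgal, ⟨e'.trans e⟩⟩
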